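/- Let $(M^n,g_M)$ be a complete connected Riemannian manifold, and let $\overline M=M\times\mathbb R$ carry the Lorentzian metric $\overline g=g_M-dt^2$. Let $F:\Sigma^n\to\overline M$ be a proper spacelike immersion of a connected smooth manifold of the same dimension as $M$. Let $\nu$ be its future-pointing unit normal ($\overline g(\nu,\nu)=-1$, $\overline g(\nu,\partial_t)<0$). Its mean curvature $H$ is the trace, with respect to the induced metric $g=F^*\overline g$, of the scalar second fundamental form $II_\nu(X,Y)=-\overline g(\overline\nabla_XF_*Y,\nu)$. Assume that $\Sigma$ is a translating soliton with respect to $\partial_t$ of velocity $c$ for some constant $c>0$, that is, $H=-c\,\overline g(\partial_t,\nu)$. Put $g_E=F^*(g_M+dt^2)$. For a continuous function $G:[0,\infty)\to\mathbb R$ consider the conditions (a) $G>0$; (b) $\int_0^\infty ds/G(s)=\infty$; (c) $G$ is nondecreasing. For $G\in C^1([0,\infty))$ consider the conditions (i) $G(0)>0$; (ii) $G'\ge 0$; (iii) $1/G\notin L^1([0,\infty))$. Then the following hold. (1) Let $r_E$ and $r$ be the distances on $\Sigma$ from a point $o\in\Sigma$ for the metrics $g_E$ and $g$, respectively. Then $(\Sigma,g)$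 is complete if either of the following holds: (1a) $H(x)\le G(r_E(x))$ for all $x\in\Sigma$, for some continuous $G$ satisfying (a) and (b); (1b) $H(x)\le G(r(x))$ for all $x\in\Sigma$, for some positive continuous function $G$ on $[0,\infty)$. (2) (2a) Suppose that $\Sigma$ is a graph over $M$, that is, $\Sigma$ is identified with its projection to $M$. Let $r_M$ be the $g_M$-distance from a point $o_M\in M$. If $H(x)\le G(r_M(x))$ for all $x$, for some continuous $G$ satisfying (a), (b) and (c) (or some $C^1$ function $G$ satisfying (i)–(iii)), then $(\Sigma,g)$ is complete. (2b) For $\Sigma$ not necessarily a graph, let $p:\tilde M\to M$ and $\pi:\tilde\Sigma\to\Sigma$ be the universal coverings, with $\tilde M$ endowed with $p^*g_M$, and let $\tilde F:\tilde\Sigma\to\tilde M\times\mathbb R$ be a lift of $F$, so that $(p\times\mathrm{id})\circ\tilde F=F\circ\pi$; its image is a graph over $\tilde M$. If the mean curvature $\tilde H$ of $\tilde F$ satisfies the bound in (2a), that is, if $\tilde H\le G(\tilde r)$ everywhere on $\tilde\Sigma$, where $\tilde r$ is the distance in $\tilde M$ from some point $\tilde o\in\tilde M$ to the $\tilde M$-component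 of $\tilde F$ and $G$ is as in (2a), then $(\Sigma,g)$ is complete. -/

import Mathlib

open Set Filter MeasureTheory
open scoped Manifold ContDiff Topology ENNReal

noncomputable section

/-! ### Riemannian metrics, their distances and completeness

All manifolds are modelled on `EuclideanSpace ℝ (Fin n)`, without boundary. -/

/-- A smooth Riemannian metric tensor on the manifold `M`. -/
abbrev RMetric (n : ℕ) (M : Type*) [TopologicalSpace M] [ChartedSpace (EuclideanSpace ℝ (Fin n)) M]
    [IsManifold (𝓡 n) ∞ M] :=
  Bundle.ContMDiffRiemannianMetric (𝓡 n) ∞ (EuclideanSpace ℝ (Fin n))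
    (fun x : M => TangentSpace (𝓡 n) x)

/-- The distance associated with a field `q` of positive definite bilinear forms: the infimum of the
lengths `∫ √q(γ', γ')` of the `C¹` curves `γ` joining two points. -/
def formEDist {n : ℕ} {X : Type*} [TopologicalSpace X] [ChartedSpace (EuclideanSpace ℝ (Fin n)) X]
    (q : ∀ x : X, TangentSpace (𝓡 n) x → TangentSpace (𝓡 n) x → ℝ) (x y : X) : ℝ≥0∞ :=
  letI : ∀ z : X, ENorm (TangentSpace (𝓡 n) z) := fun z => ⟨fun v => ENNReal.ofReal √(q z v v)⟩
  Manifold.riemannianEDist (𝓡 n) x y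

/-- The same distance as a real number (it is finite on a connected manifold). -/
def formDist {n : ℕ} {X : Type*} [TopologicalSpace X] [ChartedSpace (EuclideanSpace ℝ (Fin n)) X]
    (q : ∀ x : X, TangentSpace (𝓡 n) x → TangentSpace (𝓡 n) x → ℝ) (x y : X) : ℝ :=
  (formEDist q x y).toReal

/-- Completeness of the distance of `q`: every Cauchy sequence converges. -/
def FormComplete {n : ℕ} {X : Type*} [TopologicalSpace X]
    [ChartedSpace (EuclideanSpace ℝ (Fin n)) X]
    (q : ∀ x : X, TangentSpace (𝓡 n) x → TangentSpace (𝓡 n) x → ℝ) : Prop :=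
  ∀ u : ℕ → X,
    (∀ ε : ℝ≥0∞, 0 < ε → ∃ N : ℕ, ∀ j ≥ N, ∀ k ≥ N, formEDist q (u j) (u k) < ε) →
    ∃ x : X, Tendsto (fun k => formEDist q (u k) x) atTop (𝓝 0)

/-- A metric tensor as a field of bilinear forms. -/
def metricForm {n : ℕ} {M : Type*} [TopologicalSpace M] [ChartedSpace (EuclideanSpace ℝ (Fin n)) M]
    [IsManifold (𝓡 n) ∞ M] (gM : RMetric n M) (y : M) (v w : TangentSpace (𝓡 n) y) : ℝ :=
  gM.inner y v w

section Hypersurface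

variable {n : ℕ} {M : Type*} [TopologicalSpace M] [ChartedSpace (EuclideanSpace ℝ (Fin n)) M]
  [IsManifold (𝓡 n) ∞ M]
  {S : Type*} [TopologicalSpace S] [ChartedSpace (EuclideanSpace ℝ (Fin n)) S]

/-- The product metric `g_M + ε dt²` on `T_(y,t)(M × ℝ) = T_yM × ℝ`; the Lorentzian product is
`ε = -1`, the Riemannian product is `ε = 1`. -/
def productForm (ε : ℝ) (gM : RMetric n M) (y : M) (V W : TangentSpace (𝓡 n) y × ℝ) : ℝ :=
  gM.inner y V.1 W.1 + ε * (V.2 * W.2)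

/-- The differential of `F : S → M × ℝ` at `x`, by components. -/
def pushVec (F : S → M × ℝ) (x : S) (v : TangentSpace (𝓡 n) x) :
    TangentSpace (𝓡 n) (F x).1 × ℝ :=
  (mfderiv (𝓡 n) (𝓡 n) (fun p => (F p).1) x v, mfderiv (𝓡 n) 𝓘(ℝ, ℝ) (fun p => (F p).2) x v)

/-- The form `F^*(g_M + ε dt²)` on `S`: for `ε = -1` this is the induced metric `g`, for `ε = 1` it
is `g_E`. -/
def inducedForm (ε : ℝ) (gM : RMetric n M) (F : S → M × ℝ) (x : S)
    (v w : TangentSpace (𝓡 n) x) : ℝ :=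
  productForm ε gM (F x).1 (pushVec F x v) (pushVec F x w)

/-- `F` is a smooth spacelike immersion: the form induced from `g_M - dt²` is positive definite (so
that `dF` is injective). As `S` and `M` have the same dimension, `S` is a hypersurface. -/
structure IsSpacelikeImmersion (gM : RMetric n M) (F : S → M × ℝ) : Prop where
  smooth : ContMDiff (𝓡 n) ((𝓡 n).prod 𝓘(ℝ, ℝ)) ∞ F
  pos : ∀ (x : S) (v : TangentSpace (𝓡 n) x), v ≠ 0 → 0 < inducedForm (-1) gM F x v v

/-- `ν` is the future-pointing unit normal of `F` in `(M × ℝ, g_M - dt²)`. -/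
structure IsFutureUnitNormal (gM : RMetric n M) (F : S → M × ℝ)
    (ν : ∀ x : S, TangentSpace (𝓡 n) (F x).1 × ℝ) : Prop where
  normal : ∀ (x : S) (v : TangentSpace (𝓡 n) x),
    productForm (-1) gM (F x).1 (pushVec F x v) (ν x) = 0
  unit : ∀ x : S, productForm (-1) gM (F x).1 (ν x) (ν x) = -1
  future : ∀ x : S, productForm (-1) gM (F x).1 (ν x) (0, 1) < 0

/-- The coefficients of `g_M`, at the point of coordinates `z`, in the preferred chart at `y₀`:
`g_M(∂_v, ∂_w)` for coordinate vectors `v`, `w`. -/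
def chartMetric (gM : RMetric n M) (y₀ : M) (z v w : EuclideanSpace ℝ (Fin n)) : ℝ :=
  gM.inner ((extChartAt (𝓡 n) y₀).symm z)
    (mfderiv 𝓘(ℝ, EuclideanSpace ℝ (Fin n)) (𝓡 n) (extChartAt (𝓡 n) y₀).symm z v)
    (mfderiv 𝓘(ℝ, EuclideanSpace ℝ (Fin n)) (𝓡 n) (extChartAt (𝓡 n) y₀).symm z w)

/-- Christoffel symbols of the first kind, at `y₀` in the preferred chart there: for the Levi-Civita
connection, `g_M(∇_{∂_u} ∂_v, ∂_w) = ½ (∂_u g_{vw} + ∂_v g_{uw} - ∂_w g_{uv})`. -/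
def christoffelFirst (gM : RMetric n M) (y₀ : M) (u v w : EuclideanSpace ℝ (Fin n)) : ℝ :=
  (fderiv ℝ (fun z => chartMetric gM y₀ z v w) (extChartAt (𝓡 n) y₀ y₀) u
    + fderiv ℝ (fun z => chartMetric gM y₀ z u w) (extChartAt (𝓡 n) y₀ y₀) v
    - fderiv ℝ (fun z => chartMetric gM y₀ z u v) (extChartAt (𝓡 n) y₀ y₀) w) / 2

/-- The number `ḡ(∇̄_{F_*∂_v} F_*∂_w, ξ)` at `x`, where `ḡ = g_M - dt²`, `∇̄` is its Levi-Civita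
connection and `∂_v`, `∂_w` are the coordinate fields of the preferred chart of `S` at `x`. With
`F = (φ, h)`, the `M`-component of `∇̄_{F_*∂_v} F_*∂_w` is `D²φ(v, w) + Γ(dφ v, dφ w)` in the
preferred charts at `x` and `φ x`, and its `∂_t`-component is `D²h(v, w)`. The tangent spaces at `x`
and at `φ x` are identified with `EuclideanSpace ℝ (Fin n)` by these same charts. -/
def covDerivPairing (gM : RMetric n M) (F : S → M × ℝ) (x : S) (v w : TangentSpace (𝓡 n) x)
    (ξ : TangentSpace (𝓡 n) (F x).1 × ℝ) : ℝ :=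
  productForm (-1) gM (F x).1
      (fderiv ℝ (fderiv ℝ (writtenInExtChartAt (𝓡 n) (𝓡 n) x (fun p => (F p).1)))
          (extChartAt (𝓡 n) x x) v w,
        fderiv ℝ (fderiv ℝ (writtenInExtChartAt (𝓡 n) 𝓘(ℝ, ℝ) x (fun p => (F p).2)))
          (extChartAt (𝓡 n) x x) v w) ξ
    + christoffelFirst gM (F x).1 (pushVec F x v).1 (pushVec F x w).1 ξ.1

/-- The scalar second fundamental form `II_ν(v, w) = -ḡ(∇̄_v F_*w, ν)`, so that `II = II_ν ν`. -/
def secondFundForm (gM : RMetric n M) (F : S → M × ℝ)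
    (ν : ∀ x : S, TangentSpace (𝓡 n) (F x).1 × ℝ) (x : S) (v w : TangentSpace (𝓡 n) x) : ℝ :=
  -covDerivPairing gM F x v w (ν x)

/-- The (non-normalized) mean curvature `H = ∑ g^{ij} II_ν(∂_i, ∂_j)`, the trace of the second
fundamental form with respect to the induced metric `g`; the mean curvature vector is `H ν`. -/
def meanCurvature (gM : RMetric n M) (F : S → M × ℝ)
    (ν : ∀ x : S, TangentSpace (𝓡 n) (F x).1 × ℝ) (x : S) : ℝ :=
  let e : Fin n → TangentSpace (𝓡 n) x := fun i => EuclideanSpace.single i (1 : ℝ)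
  let gram : Matrix (Fin n) (Fin n) ℝ := Matrix.of fun i j => inducedForm (-1) gM F x (e i) (e j)
  ∑ i, ∑ j, gram⁻¹ i j * secondFundForm gM F ν x (e i) (e j)

/-- `F`, with future-pointing unit normal `ν`, is a spacelike translating soliton of velocity `c > 0`
with respect to `∂_t`: `H = -c ḡ(∂_t, ν)`. -/
structure IsTranslatingSoliton (gM : RMetric n M) (F : S → M × ℝ)
    (ν : ∀ x : S, TangentSpace (𝓡 n) (F x).1 × ℝ) (c : ℝ) : Prop where
  immersion : IsSpacelikeImmersion gM F
  normal : IsFutureUnitNormal gM F ν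
  velocity_pos : 0 < c
  soliton : ∀ x : S, meanCurvature gM F ν x = -(c * productForm (-1) gM (F x).1 (0, 1) (ν x))

/-- `F` parametrizes, injectively, the graph of a real function on the set `Π(F(S)) ⊆ M`. -/
def IsGraph (F : S → M × ℝ) : Prop :=
  Function.Injective fun x => (F x).1

end Hypersurface

/-! ### Universal coverings -/

/-- `p : X' → X` is a smooth universal covering. -/
structure IsUniversalCovering {n : ℕ} {X' X : Type*}
    [TopologicalSpace X'] [ChartedSpace (EuclideanSpace ℝ (Fin n)) X']
    [TopologicalSpace X] [ChartedSpace (EuclideanSpace ℝ (Fin n)) X] (p : X' → X) : Prop where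
  simplyConnected : SimplyConnectedSpace X'
  covering : IsCoveringMap p
  surjective : Function.Surjective p
  localDiffeo : IsLocalDiffeomorph (𝓡 n) (𝓡 n) ∞ p

/-- `F' : S' → M' × ℝ` is a lift of `F : S → M × ℝ` to the universal coverings `π : S' → S` and
`p : M' → M`, where `M'` carries the pulled back metric `g' = p^* g_M`. -/
structure IsUniversalLift {n : ℕ} {M S M' S' : Type*}
    [TopologicalSpace M] [ChartedSpace (EuclideanSpace ℝ (Fin n)) M] [IsManifold (𝓡 n) ∞ M]
    [TopologicalSpace S] [ChartedSpace (EuclideanSpace ℝ (Fin n)) S]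
    [TopologicalSpace M'] [ChartedSpace (EuclideanSpace ℝ (Fin n)) M'] [IsManifold (𝓡 n) ∞ M']
    [TopologicalSpace S'] [ChartedSpace (EuclideanSpace ℝ (Fin n)) S']
    (gM : RMetric n M) (F : S → M × ℝ) (p : M' → M) (g' : RMetric n M') (π : S' → S)
    (F' : S' → M' × ℝ) : Prop where
  baseCover : IsUniversalCovering (n := n) p
  domainCover : IsUniversalCovering (n := n) π
  pullback : ∀ (y : M') (v w : TangentSpace (𝓡 n) y),
    g'.inner y v w = gM.inner (p y) (mfderiv (𝓡 n) (𝓡 n) p y v) (mfderiv (𝓡 n) (𝓡 n) p y w)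
  smooth : ContMDiff (𝓡 n) ((𝓡 n).prod 𝓘(ℝ, ℝ)) ∞ F'
  commutes : ∀ x : S', (p (F' x).1, (F' x).2) = F (π x)

/-! ### Growth conditions on `G : [0, ∞) → ℝ` (values at negative numbers play no role) -/

/-- `G` is continuous on `[0, ∞)`, (a) `G > 0`, and (b) `∫₀^∞ ds / G(s) = ∞`. -/
structure IsPrimaryBound (G : ℝ → ℝ) : Prop where
  cont : ContinuousOn G (Ici 0)
  pos : ∀ s : ℝ, 0 ≤ s → 0 < G s
  diverges : Tendsto (fun R : ℝ => ∫ s in (0 : ℝ)..R, 1 / G s) atTop atTop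

/-- `G` satisfies (a), (b) and (c): `G` is nondecreasing. -/
structure IsMonotonePrimaryBound (G : ℝ → ℝ) : Prop extends IsPrimaryBound G where
  mono : MonotoneOn G (Ici 0)

/-- `G` is `C¹` on `[0, ∞)`, (i) `G(0) > 0`, (ii) `G' ≥ 0` and (iii) `1/G ∉ L¹([0, ∞))`. -/
structure IsSmoothPrimaryBound (G : ℝ → ℝ) : Prop where
  smooth : ContDiffOn ℝ 1 G (Ici 0)
  pos_zero : 0 < G 0
  deriv_nonneg : ∀ s : ℝ, 0 ≤ s → 0 ≤ derivWithin G (Ici 0) s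
  not_integrable : ¬ IntegrableOn (fun s => 1 / G s) (Ici 0)

end

/-! Write `ν = (ν_M, ν_t)` and let a tangent vector of the hypersurface be `dF v = (V, a)`.
Normality says `g_M(V, ν_M) = a ν_t`, and the unit condition says `|ν_M|² = ν_t² - 1`.
Cauchy–Schwarz in `g_M` then gives `a² ν_t² ≤ |V|² (ν_t² - 1)`, that is `|V| ≤ ν_t |v|_g`: along a
curve the projection to `M` moves at most `ν_t` times as fast as the curve does for `g`. The soliton
equation reads `H = c ν_t`, so a bound on `H` is a bound on this factor.

If `ν_t` is bounded on every `g`-ball of radius two, `F` maps `g`-Cauchy sequences to Cauchy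
sequences in `M` and in `ℝ`. Completeness of `M` gives a limit of the images, and properness turns
it into a cluster point on the hypersurface; a Cauchy sequence converges to its cluster point
(`formComplete_of_normal_bound`).

It remains to bound `ν_t` on balls. Let `R` be the distance in the hypothesis `H ≤ G(R)`, taken
along a curve. For `r_E` and for the distances in `M` and its universal covering, `|R'| ≤ A |V| ≤ (A
/ c) G(R) |v|_g`, hence `∫ dR / G(R)` is at most `A / c` times the `g`-length
(`integral_inv_le_of_curve`). Since `∫ ds / G = ∞`, `R` stays in a compact interval on which `G` is
bounded. Here `A = √2` for `r_E`, because `g_E ≤ 2 |V|²`, and `A = 1` for the other two. For the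
induced distance itself, `R` grows by less than two on the ball and no integral is needed.

For the lift to universal coverings, curves are lifted, and the mean curvature is shown to be
invariant (`IsUniversalLift.meanCurvature_eq`). In coordinates the second derivative of the covering
of `M` is absorbed by the Christoffel symbols (`christoffelFirst_pullback`), that of the covering of
the domain contributes a tangential term killed by the normal (`covDerivPairing_lift`), the normals
correspond by uniqueness, and the trace does not depend on the basis. -/

noncomputable section

/-! ### Distances of fields of quadratic forms -/

section FormDistance

variable {n : ℕ} {X : Type*} [TopologicalSpace X] [ChartedSpace (EuclideanSpace ℝ (Fin n)) X]

/-- The speed of a curve, measured by a field of forms. -/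
def formSpeed (q : ∀ x : X, TangentSpace (𝓡 n) x → TangentSpace (𝓡 n) x → ℝ)
    (γ : ℝ → X) (t : ℝ) : ℝ :=
  √(q (γ t) (mfderiv 𝓘(ℝ, ℝ) (𝓡 n) γ t (1 : ℝ)) (mfderiv 𝓘(ℝ, ℝ) (𝓡 n) γ t (1 : ℝ)))

/-- The length of a curve, measured by a field of forms. -/
def formLength (q : ∀ x : X, TangentSpace (𝓡 n) x → TangentSpace (𝓡 n) x → ℝ)
    (γ : ℝ → X) (a b : ℝ) : ℝ≥0∞ :=
  ∫⁻ t in Ioo a b, ENNReal.ofReal (formSpeed q γ t)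

/-- The form is homogeneous of degree two on the diagonal. -/
def FormHomogeneous (q : ∀ x : X, TangentSpace (𝓡 n) x → TangentSpace (𝓡 n) x → ℝ) : Prop :=
  ∀ (x : X) (a : ℝ) (v : TangentSpace (𝓡 n) x), q x (a • v) (a • v) = a ^ 2 * q x v v

variable {q : ∀ x : X, TangentSpace (𝓡 n) x → TangentSpace (𝓡 n) x → ℝ}

lemma exists_formLength_lt {x y : X} {r : ℝ≥0∞} (h : formEDist q x y < r) :
    ∃ γ : ℝ → X, γ 0 = x ∧ γ 1 = y ∧ ContMDiffOn 𝓘(ℝ, ℝ) (𝓡 n) 1 γ (Icc 0 1) ∧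
      formLength q γ 0 1 < r := by
  let _ : ∀ z : X, ENorm (TangentSpace (𝓡 n) z) := fun z => ⟨fun v => ENNReal.ofReal √(q z v v)⟩
  obtain ⟨γ, h0, h1, hγ, hl⟩ := Manifold.exists_lt_of_riemannianEDist_lt h
  refine ⟨γ, h0, h1, hγ, ?_⟩
  rw [Manifold.pathELength_eq_lintegral_mfderiv_Ioo] at hl
  exact hl

/-- The distance is an infimum over curves on `[0, 1]`. Homogeneity of degree two makes `√q` scale
like a norm, so length survives affine reparametrization and curves on `[a, b]` compete as well. -/
lemma FormHomogeneous.formEDist_le (hq : FormHomogeneous q) {γ : ℝ → X} {a b : ℝ} (hab : a ≤ b)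
    (hγ : ContMDiffOn 𝓘(ℝ, ℝ) (𝓡 n) 1 γ (Icc a b)) :
    formEDist q (γ a) (γ b) ≤ formLength q γ a b := by
  let _ : ∀ z : X, ENorm (TangentSpace (𝓡 n) z) := fun z => ⟨fun v => ENNReal.ofReal √(q z v v)⟩
  have : ∀ z : X, ENormSMulClass ℝ (TangentSpace (𝓡 n) z) := fun z => ⟨fun c v => by
    change ENNReal.ofReal √(q z (c • v) (c • v)) = ‖c‖ₑ * ENNReal.ofReal √(q z v v)
    rw [hq, Real.sqrt_mul (sq_nonneg c), Real.sqrt_sq_eq_abs, ENNReal.ofReal_mul (abs_nonneg c),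
      Real.enorm_eq_ofReal_abs]⟩
  have := Manifold.riemannianEDist_le_pathELength hγ rfl rfl hab
  rwa [Manifold.pathELength_eq_lintegral_mfderiv_Ioo] at this

lemma FormHomogeneous.formEDist_triangle (hq : FormHomogeneous q) (x y z : X) :
    formEDist q x z ≤ formEDist q x y + formEDist q y z := by
  let _ : ∀ z : X, ENorm (TangentSpace (𝓡 n) z) := fun z => ⟨fun v => ENNReal.ofReal √(q z v v)⟩
  have : ∀ z : X, ENormSMulClass ℝ (TangentSpace (𝓡 n) z) := fun z => ⟨fun c v => by
    change ENNReal.ofReal √(q z (c • v) (c • v)) = ‖c‖ₑ * ENNReal.ofReal √(q z v v)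
    rw [hq, Real.sqrt_mul (sq_nonneg c), Real.sqrt_sq_eq_abs, ENNReal.ofReal_mul (abs_nonneg c),
      Real.enorm_eq_ofReal_abs]⟩
  exact Manifold.riemannianEDist_triangle

lemma FormHomogeneous.formEDist_comm (hq : FormHomogeneous q) (x y : X) :
    formEDist q x y = formEDist q y x := by
  let _ : ∀ z : X, ENorm (TangentSpace (𝓡 n) z) := fun z => ⟨fun v => ENNReal.ofReal √(q z v v)⟩
  have : ∀ z : X, ENormSMulClass ℝ (TangentSpace (𝓡 n) z) := fun z => ⟨fun c v => by
    change ENNReal.ofReal √(q z (c • v) (c • v)) = ‖c‖ₑ * ENNReal.ofReal √(q z v v)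
    rw [hq, Real.sqrt_mul (sq_nonneg c), Real.sqrt_sq_eq_abs, ENNReal.ofReal_mul (abs_nonneg c),
      Real.enorm_eq_ofReal_abs]⟩
  exact Manifold.riemannianEDist_comm

/-- The real-valued distance to a point is Lipschitz, including where it is infinite. -/
lemma FormHomogeneous.abs_formDist_sub_le (hq : FormHomogeneous q) (o x y : X)
    (h : formEDist q x y ≠ ⊤) :
    |formDist q o y - formDist q o x| ≤ (formEDist q x y).toReal := by
  -- A finite distance between `x` and `y` makes both distances to `o` infinite together, and then
  -- both real values are the default `0`.
  by_cases hx : formEDist q o x = ⊤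
  · have hy : formEDist q o y = ⊤ := by
      by_contra hy
      have := hq.formEDist_triangle o y x
      rw [hx, hq.formEDist_comm y x] at this
      exact (ENNReal.add_ne_top.2 ⟨hy, h⟩) (top_le_iff.1 this)
    simp [formDist, hx, hy]
  · have hy : formEDist q o y ≠ ⊤ := fun hy => by
      have := hq.formEDist_triangle o x y
      rw [hy] at this
      exact (ENNReal.add_ne_top.2 ⟨hx, h⟩) (top_le_iff.1 this)
    have h1 := ENNReal.toReal_mono (ENNReal.add_ne_top.2 ⟨hx, h⟩) (hq.formEDist_triangle o x y)
    have h2 := ENNReal.toReal_mono (ENNReal.add_ne_top.2 ⟨hy, h⟩)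
      ((hq.formEDist_triangle o y x).trans_eq (by rw [hq.formEDist_comm y x]))
    rw [ENNReal.toReal_add hx h] at h1
    rw [ENNReal.toReal_add hy h] at h2
    unfold formDist
    rw [abs_le]
    constructor <;> linarith

end FormDistance

/-! ### Riemannian metrics -/

section Metric

open scoped Bundle

variable {n : ℕ} {M : Type*} [TopologicalSpace M] [ChartedSpace (EuclideanSpace ℝ (Fin n)) M]
  [IsManifold (𝓡 n) ∞ M]

lemma metricForm_homogeneous (gM : RMetric n M) : FormHomogeneous (metricForm gM) := by
  intro x a v
  simp only [metricForm, map_smul, smul_apply, smul_eq_mul]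
  ring

lemma metricForm_nonneg (gM : RMetric n M) (x : M) (v : TangentSpace (𝓡 n) x) :
    0 ≤ gM.inner x v v := by
  by_cases hv : v = 0
  · simp [hv]
  · exact (gM.pos x v hv).le

/-- The distance defined by the form is the Riemannian distance of the bundle metric, whose small
balls lie inside any given neighbourhood. Local compactness together with the Hausdorff property
provides the regularity behind this. -/
lemma tendsto_nhds_of_formEDist [T2Space M] (gM : RMetric n M) {u : ℕ → M} {x : M}
    (h : Tendsto (fun k => formEDist (metricForm gM) (u k) x) atTop (𝓝 0)) :
    Tendsto u atTop (𝓝 x) := by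
  have : LocallyCompactSpace M := Manifold.locallyCompact_of_finiteDimensional (𝓡 n)
  let _ : Bundle.RiemannianBundle (fun x : M => TangentSpace (𝓡 n) x) := ⟨gM.toRiemannianMetric⟩
  have : IsContinuousRiemannianBundle (EuclideanSpace ℝ (Fin n))
      (fun x : M => TangentSpace (𝓡 n) x) :=
    ⟨gM.inner, gM.contMDiff.continuous, fun _ _ _ => rfl⟩
  have key : ∀ y, formEDist (metricForm gM) y x = Manifold.riemannianEDist (𝓡 n) x y := by
    intro y
    rw [(metricForm_homogeneous gM).formEDist_comm]
    unfold formEDist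
    congr 1
    funext z
    congr 1
    funext v
    exact (congrArg ENNReal.ofReal (norm_eq_sqrt_real_inner v)).symm.trans (ofReal_norm v)
  rw [tendsto_def]
  intro s hs
  obtain ⟨c, hc, hsub⟩ := setOfPred_riemannianEDist_lt_subset_nhds' (𝓡 n) hs
  filter_upwards [h.eventually_lt_const hc] with k hk
  exact hsub ((key _).symm.trans_lt hk)

/-- At the endpoints `mfderiv` may take a junk value, since the curve is `C¹` only on the closed
interval. The one-sided derivative gives a speed continuous up to the ends, with the same value
inside. -/
lemma continuousOn_formSpeed (gM : RMetric n M) {γ : ℝ → M} {a b : ℝ}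
    (hγ : ContMDiffOn 𝓘(ℝ, ℝ) (𝓡 n) 1 γ (Icc a b)) :
    ∃ w : ℝ → ℝ, ContinuousOn w (Icc a b) ∧ (∀ t, 0 ≤ w t) ∧
      ∀ t ∈ Ioo a b, w t = formSpeed (metricForm gM) γ t := by
  let _ : Bundle.RiemannianBundle (fun x : M => TangentSpace (𝓡 n) x) := ⟨gM.toRiemannianMetric⟩
  have : IsContinuousRiemannianBundle (EuclideanSpace ℝ (Fin n))
      (fun x : M => TangentSpace (𝓡 n) x) :=
    ⟨gM.inner, gM.contMDiff.continuous, fun _ _ _ => rfl⟩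
  refine ⟨fun t => ‖mfderivWithin 𝓘(ℝ, ℝ) (𝓡 n) γ (Icc a b) t (1 : ℝ)‖, ?_,
    fun t => norm_nonneg _, ?_⟩
  · rcases lt_or_ge a b with hab | hab
    · have h1 : ContinuousOn (fun t : ℝ => (⟨t, (1 : ℝ)⟩ : TangentBundle 𝓘(ℝ, ℝ) ℝ)) (Icc a b) := by
        have : Continuous fun t : ℝ => (t, (1 : ℝ)) := by fun_prop
        exact ((tangentBundleModelSpaceHomeomorph 𝓘(ℝ, ℝ)).symm.continuous.comp this).continuousOn
      have h2 := hγ.continuousOn_tangentMapWithin le_rfl (uniqueDiffOn_Icc hab).uniqueMDiffOn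
      have h3 := h2.comp h1 (fun t ht => ht)
      simp only [norm_eq_sqrt_real_inner]
      exact Real.continuous_sqrt.comp_continuousOn (ContinuousOn.inner_bundle h3 h3)
    · exact Set.Subsingleton.continuousOn (subsingleton_Icc_of_ge hab) _
  · intro t ht
    simp only [norm_eq_sqrt_real_inner]
    rw [mfderivWithin_of_mem_nhds (Icc_mem_nhds ht.1 ht.2)]
    rfl

end Metric

/-! ### A differential inequality in integral form -/

/-- With `Θ' = 1 / G`, formally `(Θ ∘ R)' ≤ w / G(R)`. As `R` will be a distance function it need
not be differentiable, so the inequality is proved for right difference quotients and integrated by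
a Dini-type mean value inequality. -/
lemma integral_inv_le_of_abs_sub_le {G w R : ℝ → ℝ} (hG : Continuous G) (hGpos : ∀ s, 0 < G s)
    (hw : Continuous w) (hR : Continuous R)
    (hRw : ∀ s ∈ Icc (0 : ℝ) 1, ∀ t ∈ Icc (0 : ℝ) 1, s ≤ t → |R t - R s| ≤ ∫ x in s..t, w x) :
    ∫ s in (0 : ℝ)..(R 1), 1 / G s ≤
      (∫ s in (0 : ℝ)..(R 0), 1 / G s) + ∫ t in (0 : ℝ)..1, w t / G (R t) := by
  set Θ : ℝ → ℝ := fun r => ∫ s in (0 : ℝ)..r, 1 / G s with hΘ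
  have hGi : Continuous fun s => 1 / G s :=
    continuous_const.div hG (fun s => (hGpos s).ne')
  have hΘd : ∀ r, HasDerivAt Θ (1 / G r) r := fun r =>
    intervalIntegral.integral_hasDerivAt_right (hGi.intervalIntegrable _ _)
      hGi.aestronglyMeasurable.stronglyMeasurableAtFilter hGi.continuousAt
  have hv : Continuous fun t => w t / G (R t) := hw.div (hG.comp hR) (fun t => (hGpos _).ne')
  have hBd : ∀ x, HasDerivAt (fun x => Θ (R 0) + ∫ t in (0 : ℝ)..x, w t / G (R t))
      (w x / G (R x)) x := fun x =>
    (intervalIntegral.integral_hasDerivAt_right (hv.intervalIntegrable _ _)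
      hv.aestronglyMeasurable.stronglyMeasurableAtFilter hv.continuousAt).const_add _
  have hΘc : Continuous Θ := continuous_iff_continuousAt.2 fun r => (hΘd r).continuousAt
  refine image_le_of_liminf_slope_right_le_deriv_boundary (f := fun t => Θ (R t))
    (B := fun x => Θ (R 0) + ∫ t in (0 : ℝ)..x, w t / G (R t))
    (B' := fun x => w x / G (R x)) (a := 0) (b := 1)
    (hΘc.comp hR).continuousOn (by simp)
    (fun x _ => (hBd x).continuousAt.continuousWithinAt)
    (fun x _ => (hBd x).hasDerivWithinAt) ?_ (right_mem_Icc.2 zero_le_one)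
  intro x hx r hr
  -- The slack `η` is spent twice: on the difference quotient of `Θ` at `R x` and on the oscillation
  -- of `w` to the right of `x`.
  obtain ⟨η, hη, hηr⟩ : ∃ η > 0, (1 / G (R x) + η) * (w x + η) < r := by
    have hc : ContinuousAt (fun η : ℝ => (1 / G (R x) + η) * (w x + η)) 0 := by fun_prop
    have h0 : (fun η : ℝ => (1 / G (R x) + η) * (w x + η)) 0 < r := by
      simpa [div_eq_inv_mul] using hr
    have h1 : ∀ᶠ η in 𝓝[>] (0 : ℝ), (1 / G (R x) + η) * (w x + η) < r :=
      (hc.eventually_lt_const h0).filter_mono nhdsWithin_le_nhds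
    obtain ⟨η, h2, h3⟩ := (h1.and self_mem_nhdsWithin).exists
    exact ⟨η, h3, h2⟩
  have hpos : 0 < 1 / G (R x) := one_div_pos.2 (hGpos _)
  have e1 : ∀ᶠ a in 𝓝 (R x), |Θ a - Θ (R x)| ≤ (1 / G (R x) + η) * |a - R x| := by
    have := (hΘd (R x)).isLittleO.bound hη
    filter_upwards [this] with a ha
    simp only [Real.norm_eq_abs, smul_eq_mul] at ha
    have h1 : |Θ a - Θ (R x)| ≤ |Θ a - Θ (R x) - (a - R x) * (1 / G (R x))|
        + |(a - R x) * (1 / G (R x))| := by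
      simpa using abs_add_le (Θ a - Θ (R x) - (a - R x) * (1 / G (R x)))
        ((a - R x) * (1 / G (R x)))
    rw [abs_mul _ (1 / G (R x)), abs_of_pos hpos] at h1
    linarith
  have e2 : ∀ᶠ z in 𝓝[>] x, ∀ y ∈ Icc x z, w y ≤ w x + η := by
    have h1 : ∀ᶠ y in 𝓝 x, w y < w x + η :=
      hw.continuousAt.eventually_lt_const (by linarith)
    obtain ⟨δ, hδ, hb⟩ := Metric.eventually_nhds_iff.1 h1
    filter_upwards [Ioo_mem_nhdsGT (show x < x + δ by linarith)] with z hz y hy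
    refine (hb ?_).le
    rw [Real.dist_eq, abs_lt]
    constructor <;> linarith [hy.1, hy.2, hz.2]
  have e3 : ∀ᶠ z in 𝓝[>] x, |Θ (R z) - Θ (R x)| ≤ (1 / G (R x) + η) * |R z - R x| :=
    (hR.continuousAt.eventually e1).filter_mono nhdsWithin_le_nhds
  refine Eventually.frequently ?_
  filter_upwards [e2, e3, Ioo_mem_nhdsGT hx.2] with z h2 h3 hz
  have hxz : 0 < z - x := sub_pos.2 hz.1
  have h4 : |R z - R x| ≤ (w x + η) * (z - x) := by
    refine (hRw x ⟨hx.1, hx.2.le⟩ z ⟨hx.1.trans hz.1.le, hz.2.le⟩ hz.1.le).trans ?_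
    have := intervalIntegral.integral_mono_on hz.1.le (hw.intervalIntegrable x z)
      (intervalIntegrable_const (μ := volume) (c := w x + η)) h2
    rw [intervalIntegral.integral_const, smul_eq_mul, mul_comm] at this
    exact this
  rw [slope_def_field, div_lt_iff₀ hxz]
  calc Θ (R z) - Θ (R x) ≤ (1 / G (R x) + η) * |R z - R x| := (le_abs_self _).trans h3
    _ ≤ (1 / G (R x) + η) * ((w x + η) * (z - x)) := by gcongr
    _ = ((1 / G (R x) + η) * (w x + η)) * (z - x) := by ring
    _ < r * (z - x) := by gcongr

/-- If `R` varies at most at the speed `w` and `w ≤ C G(R) ℓ`, then `∫ 1 / G` between the extreme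
values of `R` is at most `C ∫ ℓ`. -/
lemma integral_inv_le_of_speed_le {G w R ℓ : ℝ → ℝ} {C L : ℝ} (hC : 0 ≤ C) (hL : 0 ≤ L)
    (hG : ContinuousOn G (Ici 0))
    (hGpos : ∀ s, 0 ≤ s → 0 < G s) (hw : ContinuousOn w (Icc 0 1)) (hw0 : ∀ t, 0 ≤ w t)
    (hR0 : ∀ t, 0 ≤ R t)
    (hRw : ∀ s ∈ Icc (0 : ℝ) 1, ∀ t ∈ Icc (0 : ℝ) 1, s ≤ t → |R t - R s| ≤ ∫ x in s..t, w x)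
    (hwl : ∀ t ∈ Ioo (0 : ℝ) 1, w t ≤ C * G (R t) * ℓ t)
    (hl : ∫⁻ t in Ioo (0 : ℝ) 1, ENNReal.ofReal (ℓ t) ≤ ENNReal.ofReal L) :
    ∫ s in (0 : ℝ)..(R 1), 1 / G s ≤ (∫ s in (0 : ℝ)..(R 0), 1 / G s) + C * L := by
  -- Clamping time to `[0, 1]`, and below the argument of `G` to `[0, ∞)`, produces functions
  -- continuous on the whole line, as the previous lemma requires.
  let P : ℝ → ℝ := fun t => projIcc (0 : ℝ) 1 zero_le_one t
  have hP : Continuous P := continuous_subtype_val.comp continuous_projIcc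
  have hPm : ∀ t, P t ∈ Icc (0 : ℝ) 1 := fun t => Subtype.property _
  have hPe : ∀ t ∈ Icc (0 : ℝ) 1, P t = t := fun t ht => by
    simp only [P, projIcc_of_mem zero_le_one ht]
  have hwc : Continuous (w ∘ P) := hw.comp_continuous hP hPm
  have hwi : ∀ s ∈ Icc (0 : ℝ) 1, ∀ t ∈ Icc (0 : ℝ) 1, s ≤ t →
      ∫ x in s..t, w x = ∫ x in s..t, (w ∘ P) x := by
    intro s hs t ht hst
    refine intervalIntegral.integral_congr fun x hx => ?_
    rw [uIcc_of_le hst] at hx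
    simp only [Function.comp, hPe x ⟨hs.1.trans hx.1, hx.2.trans ht.2⟩]
  have hI : Continuous fun t => ∫ x in (0 : ℝ)..t, (w ∘ P) x :=
    intervalIntegral.continuous_primitive (fun a b => hwc.intervalIntegrable a b) 0
  -- The increments of `R` are dominated by those of a primitive of `w`, which is continuous.
  have hRc : ContinuousOn R (Icc 0 1) := by
    intro x hx
    rw [Metric.continuousWithinAt_iff]
    intro ε hε
    obtain ⟨δ, hδ, hb⟩ := Metric.continuousAt_iff.1 (hI.continuousAt (x := x)) ε hε
    refine ⟨δ, hδ, fun {y} hy hyx => ?_⟩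
    have h1 := hb hyx
    rw [Real.dist_eq] at h1 ⊢
    rw [intervalIntegral.integral_interval_sub_left (hwc.intervalIntegrable _ _)
      (hwc.intervalIntegrable _ _)] at h1
    rcases le_total x y with h | h
    · refine (hRw x hx y hy h).trans_lt ?_
      rw [hwi x hx y hy h]
      exact (le_abs_self _).trans_lt h1
    · rw [abs_sub_comm]
      refine (hRw y hy x hx h).trans_lt ?_
      rw [hwi y hy x hx h]
      rw [intervalIntegral.integral_symm, abs_neg] at h1
      exact (le_abs_self _).trans_lt h1
  let Γ : ℝ → ℝ := fun s => G (max s 0)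
  have hΓ : Continuous Γ := hG.comp_continuous (by fun_prop) (fun s => mem_Ici.2 (le_max_right _ _))
  have hΓpos : ∀ s, 0 < Γ s := fun s => hGpos _ (le_max_right _ _)
  have hΓe : ∀ s, 0 ≤ s → Γ s = G s := fun s hs => by simp [Γ, hs]
  have hΘe : ∀ r, 0 ≤ r → ∫ s in (0 : ℝ)..r, 1 / G s = ∫ s in (0 : ℝ)..r, 1 / Γ s := by
    intro r hr
    refine intervalIntegral.integral_congr fun x hx => ?_
    rw [uIcc_of_le hr] at hx
    simp only [hΓe x hx.1]
  have key := integral_inv_le_of_abs_sub_le (G := Γ) (w := w ∘ P) (R := R ∘ P) hΓ hΓpos hwc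
    (hRc.comp_continuous hP hPm) (by
      intro s hs t ht hst
      simp only [Function.comp_apply, hPe s hs, hPe t ht]
      exact (hRw s hs t ht hst).trans_eq (hwi s hs t ht hst))
  simp only [Function.comp_apply, hPe 0 (by simp), hPe 1 (by simp)] at key
  rw [hΘe _ (hR0 _), hΘe _ (hR0 _)]
  refine key.trans (add_le_add_right ?_ _)
  -- In terms of lower Lebesgue integrals the comparison with `ℓ` needs neither measurability nor
  -- integrability of `ℓ`.
  rw [intervalIntegral.integral_of_le zero_le_one, ← restrict_Ioo_eq_restrict_Ioc,
    integral_eq_lintegral_of_nonneg_ae (ae_of_all _ fun t => div_nonneg (hw0 _) (hΓpos _).le)]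
  · refine ENNReal.toReal_le_of_le_ofReal (by positivity) ?_
    rw [ENNReal.ofReal_mul hC]
    refine le_trans ?_ (mul_le_mul_right hl _)
    rw [← lintegral_const_mul' _ _ ENNReal.ofReal_ne_top]
    refine setLIntegral_mono' measurableSet_Ioo fun t ht => ?_
    rw [← ENNReal.ofReal_mul hC, hPe t (Ioo_subset_Icc_self ht), hΓe _ (hR0 _)]
    refine ENNReal.ofReal_le_ofReal ?_
    rw [div_le_iff₀ (hGpos _ (hR0 _))]
    linarith [hwl t ht, mul_right_comm C (G (R t)) (ℓ t)]
  · exact (hwc.div (hΓ.comp (hRc.comp_continuous hP hPm))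
      (fun t => (hΓpos _).ne')).aestronglyMeasurable

/-- A primitive of `1 / G` which diverges at infinity bounds its argument. -/
lemma IsPrimaryBound.exists_bound {G : ℝ → ℝ} (hG : IsPrimaryBound G) (A : ℝ) :
    ∃ B : ℝ, ∀ r : ℝ, 0 ≤ r → ∫ s in (0 : ℝ)..r, 1 / G s ≤ A → G r ≤ B := by
  -- Beyond `r₀` the primitive exceeds `A`, so `r ≤ r₀`; `B` bounds the continuous `G` on the
  -- compact interval `[0, r₀]`.
  obtain ⟨r₀, hr₀⟩ := (hG.diverges.eventually_gt_atTop A).exists_forall_of_atTop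
  obtain ⟨B, hB⟩ := (isCompact_Icc (a := (0 : ℝ)) (b := r₀)).bddAbove_image
    (hG.cont.mono Icc_subset_Ici_self)
  refine ⟨B, fun r hr hA => hB (mem_image_of_mem _ ⟨hr, ?_⟩)⟩
  by_contra! h
  exact absurd (hr₀ r h.le) (not_lt.2 hA)

/-- Monotonicity gives `G ≥ G(0) > 0`, so the primitive of `1 / G` is nondecreasing. If it did not
tend to infinity it would be bounded, and the positive function `1 / G` would be integrable. -/
lemma IsSmoothPrimaryBound.isPrimaryBound {G : ℝ → ℝ} (hG : IsSmoothPrimaryBound G) :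
    IsPrimaryBound G := by
  have hmono : MonotoneOn G (Ici 0) := by
    refine monotoneOn_of_deriv_nonneg (convex_Ici 0) hG.smooth.continuousOn ?_ ?_
    · exact (hG.smooth.differentiableOn one_ne_zero).mono interior_subset
    · intro x hx
      have := hG.deriv_nonneg x (interior_subset hx)
      rwa [derivWithin_of_mem_nhds (mem_interior_iff_mem_nhds.1 hx)] at this
  have hpos : ∀ s : ℝ, 0 ≤ s → 0 < G s := fun s hs =>
    hG.pos_zero.trans_le (hmono self_mem_Ici hs hs)
  have hc : ContinuousOn (fun s => 1 / G s) (Ici 0) :=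
    continuousOn_const.div hG.smooth.continuousOn fun s hs => (hpos s hs).ne'
  have hint : ∀ a b : ℝ, 0 ≤ a → 0 ≤ b → IntervalIntegrable (fun s => 1 / G s) volume a b :=
    fun a b ha hb => (hc.mono fun x hx => (le_min ha hb).trans hx.1).intervalIntegrable
  refine ⟨hG.smooth.continuousOn, hpos, ?_⟩
  have hm : MonotoneOn (fun R : ℝ => ∫ s in (0 : ℝ)..R, 1 / G s) (Ici 0) := by
    intro a ha b hb hab
    have h1 := intervalIntegral.integral_add_adjacent_intervals (hint 0 a le_rfl ha)
      (hint a b ha hb)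
    have h2 : 0 ≤ ∫ s in a..b, 1 / G s := intervalIntegral.integral_nonneg hab fun s hs =>
      (one_div_pos.2 (hpos s (le_trans ha hs.1))).le
    simp only
    linarith
  by_contra hnot
  obtain ⟨B, hB⟩ : ∃ B : ℝ, ∀ r, 0 ≤ r → ∫ s in (0 : ℝ)..r, 1 / G s ≤ B := by
    by_contra! hB
    refine hnot (tendsto_atTop.2 fun b => ?_)
    obtain ⟨r, hr, hb⟩ := hB b
    filter_upwards [eventually_ge_atTop r] with x hx
    exact hb.le.trans (hm hr (hr.trans hx) hx)
  refine hG.not_integrable ?_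
  rw [integrableOn_Ici_iff_integrableOn_Ioi]
  refine integrableOn_Ioi_of_intervalIntegral_norm_bounded (l := atTop) (b := id) B 0 ?_
    tendsto_id ?_
  · intro r
    rcases le_total 0 r with hr | hr
    · exact (intervalIntegrable_iff_integrableOn_Ioc_of_le hr).1 (hint 0 r le_rfl hr)
    · simp [Ioc_eq_empty_of_le hr]
  · filter_upwards [eventually_ge_atTop 0] with r hr
    refine le_trans (le_of_eq ?_) (hB r hr)
    refine intervalIntegral.integral_congr fun x hx => ?_
    rw [id, uIcc_of_le hr] at hx
    exact abs_of_pos (one_div_pos.2 (hpos x hx.1))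

lemma isPrimaryBound_of_or {G : ℝ → ℝ} (h : IsMonotonePrimaryBound G ∨ IsSmoothPrimaryBound G) :
    IsPrimaryBound G :=
  h.elim (fun h => h.toIsPrimaryBound) (fun h => h.isPrimaryBound)

/-! ### Spacelike immersions in a Lorentzian product -/

section Spacelike

open scoped Bundle

variable {n : ℕ} {M : Type*} [TopologicalSpace M] [ChartedSpace (EuclideanSpace ℝ (Fin n)) M]
  [IsManifold (𝓡 n) ∞ M]
  {S : Type*} [TopologicalSpace S] [ChartedSpace (EuclideanSpace ℝ (Fin n)) S]
  {gM : RMetric n M} {F : S → M × ℝ} {ν : ∀ x : S, TangentSpace (𝓡 n) (F x).1 × ℝ}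

lemma metric_inner_sq_le (gM : RMetric n M) (y : M) (v w : TangentSpace (𝓡 n) y) :
    gM.inner y v w ^ 2 ≤ gM.inner y v v * gM.inner y w w := by
  let _ : Bundle.RiemannianBundle (fun x : M => TangentSpace (𝓡 n) x) := ⟨gM.toRiemannianMetric⟩
  rw [sq]
  exact real_inner_mul_inner_self_le (F := TangentSpace (𝓡 n) y) v w

lemma IsSpacelikeImmersion.fst (hF : IsSpacelikeImmersion gM F) :
    ContMDiff (𝓡 n) (𝓡 n) ∞ fun p => (F p).1 :=
  hF.smooth.fst

lemma IsSpacelikeImmersion.snd (hF : IsSpacelikeImmersion gM F) :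
    ContMDiff (𝓡 n) 𝓘(ℝ, ℝ) ∞ fun p => (F p).2 :=
  hF.smooth.snd

lemma IsFutureUnitNormal.snd_pos (hν : IsFutureUnitNormal gM F ν) (x : S) : 0 < (ν x).2 := by
  have := hν.future x
  simp only [productForm, map_zero] at this
  linarith

lemma IsFutureUnitNormal.inner_fst (hν : IsFutureUnitNormal gM F ν) (x : S) :
    gM.inner (F x).1 (ν x).1 (ν x).1 = (ν x).2 ^ 2 - 1 := by
  have := hν.unit x
  simp only [productForm] at this
  linarith

lemma IsFutureUnitNormal.inner_pushVec (hν : IsFutureUnitNormal gM F ν) (x : S)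
    (v : TangentSpace (𝓡 n) x) :
    gM.inner (F x).1 (pushVec F x v).1 (ν x).1 = (pushVec F x v).2 * (ν x).2 := by
  have := hν.normal x v
  simp only [productForm] at this
  linarith

/-- Since `ḡ(∂_t, ν) = -ν_t`, the soliton equation converts mean curvature bounds into slope bounds;
this is its only role in the argument. -/
lemma IsTranslatingSoliton.meanCurvature_eq {c : ℝ} (hF : IsTranslatingSoliton gM F ν c) (x : S) :
    meanCurvature gM F ν x = c * (ν x).2 := by
  rw [hF.soliton]
  simp only [productForm, map_zero, zero_apply]
  ring

/-- The vertical component of a tangent vector is dominated by the horizontal one. -/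
lemma IsFutureUnitNormal.pushVec_snd_sq_mul_le (hν : IsFutureUnitNormal gM F ν) (x : S)
    (v : TangentSpace (𝓡 n) x) :
    (pushVec F x v).2 ^ 2 * (ν x).2 ^ 2 ≤
      gM.inner (F x).1 (pushVec F x v).1 (pushVec F x v).1 * ((ν x).2 ^ 2 - 1) := by
  have := metric_inner_sq_le gM (F x).1 (pushVec F x v).1 (ν x).1
  rwa [hν.inner_pushVec, hν.inner_fst, mul_pow] at this

lemma IsFutureUnitNormal.pushVec_snd_sq_le (hν : IsFutureUnitNormal gM F ν) (x : S)
    (v : TangentSpace (𝓡 n) x) :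
    (pushVec F x v).2 ^ 2 ≤ gM.inner (F x).1 (pushVec F x v).1 (pushVec F x v).1 := by
  have h1 := hν.pushVec_snd_sq_mul_le x v
  have h2 := metricForm_nonneg gM (F x).1 (pushVec F x v).1
  have h3 : 0 < (ν x).2 ^ 2 := pow_pos (hν.snd_pos x) 2
  refine le_of_mul_le_mul_right ?_ h3
  nlinarith

/-- Rearranging `a² ν_t² ≤ |V|² (ν_t² - 1)` gives `|V|² ≤ ν_t² (|V|² - a²)`, and the last bracket is
`g(v, v)`. All length estimates rest on this. -/
lemma IsFutureUnitNormal.inner_pushVec_le (hν : IsFutureUnitNormal gM F ν) (x : S)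
    (v : TangentSpace (𝓡 n) x) :
    gM.inner (F x).1 (pushVec F x v).1 (pushVec F x v).1 ≤
      (ν x).2 ^ 2 * inducedForm (-1) gM F x v v := by
  have h1 := hν.pushVec_snd_sq_mul_le x v
  simp only [inducedForm, productForm]
  nlinarith

/-- Here `g_E(v, v) = |V|² + a²` with `a² ≤ |V|²`; this is the source of the constant `√2` below. -/
lemma IsFutureUnitNormal.inducedForm_one_le (hν : IsFutureUnitNormal gM F ν) (x : S)
    (v : TangentSpace (𝓡 n) x) :
    inducedForm 1 gM F x v v ≤ 2 * gM.inner (F x).1 (pushVec F x v).1 (pushVec F x v).1 := by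
  have h1 := hν.pushVec_snd_sq_le x v
  simp only [inducedForm, productForm]
  nlinarith

lemma inducedForm_neg_one_le (x : S) (v : TangentSpace (𝓡 n) x) :
    inducedForm (-1) gM F x v v ≤ gM.inner (F x).1 (pushVec F x v).1 (pushVec F x v).1 := by
  simp only [inducedForm, productForm]
  nlinarith [sq_nonneg (pushVec F x v).2]

lemma pushVec_smul (F : S → M × ℝ) (x : S) (a : ℝ) (v : TangentSpace (𝓡 n) x) :
    (pushVec F x (a • v)).1 = a • (pushVec F x v).1 ∧
      (pushVec F x (a • v)).2 = a * (pushVec F x v).2 :=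
  ⟨map_smul _ _ _, map_smul (mfderiv (𝓡 n) 𝓘(ℝ, ℝ) (fun p => (F p).2) x) a v⟩

lemma inducedForm_homogeneous (ε : ℝ) (gM : RMetric n M) (F : S → M × ℝ) :
    FormHomogeneous (inducedForm ε gM F) := by
  intro x a v
  simp only [inducedForm, productForm, pushVec_smul, map_smul, smul_apply, smul_eq_mul]
  ring

/-! ### Speeds of curves for the induced metrics and of their projections -/

/-- The horizontal and vertical components of the velocity of a curve in the immersed manifold. -/
lemma IsSpacelikeImmersion.mfderiv_comp_curve (hF : IsSpacelikeImmersion gM F) {γ : ℝ → S} {t : ℝ}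
    (hγ : MDifferentiableAt 𝓘(ℝ, ℝ) (𝓡 n) γ t) :
    mfderiv 𝓘(ℝ, ℝ) (𝓡 n) (fun s => (F (γ s)).1) t (1 : ℝ) =
        (pushVec F (γ t) (mfderiv 𝓘(ℝ, ℝ) (𝓡 n) γ t (1 : ℝ))).1 ∧
      mfderiv 𝓘(ℝ, ℝ) 𝓘(ℝ, ℝ) (fun s => (F (γ s)).2) t (1 : ℝ) =
        (pushVec F (γ t) (mfderiv 𝓘(ℝ, ℝ) (𝓡 n) γ t (1 : ℝ))).2 := by
  have h1 := mfderiv_comp t (hF.fst.mdifferentiableAt (by simp) (x := γ t)) hγ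
  have h2 := mfderiv_comp t (hF.snd.mdifferentiableAt (by simp) (x := γ t)) hγ
  constructor
  · exact congrArg (fun L => L (1 : ℝ)) h1
  · exact congrArg (fun L => L (1 : ℝ)) h2

lemma IsSpacelikeImmersion.formSpeed_fst_eq (hF : IsSpacelikeImmersion gM F) {γ : ℝ → S} {t : ℝ}
    (hγ : MDifferentiableAt 𝓘(ℝ, ℝ) (𝓡 n) γ t) :
    formSpeed (metricForm gM) (fun s => (F (γ s)).1) t =
      √(gM.inner (F (γ t)).1 (pushVec F (γ t) (mfderiv 𝓘(ℝ, ℝ) (𝓡 n) γ t (1 : ℝ))).1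
        (pushVec F (γ t) (mfderiv 𝓘(ℝ, ℝ) (𝓡 n) γ t (1 : ℝ))).1) := by
  unfold formSpeed metricForm
  rw [(hF.mfderiv_comp_curve hγ).1]

lemma mdifferentiableAt_of_mem_Ioo {X : Type*} [TopologicalSpace X]
    [ChartedSpace (EuclideanSpace ℝ (Fin n)) X] {γ : ℝ → X} {a b t : ℝ}
    (hγ : ContMDiffOn 𝓘(ℝ, ℝ) (𝓡 n) 1 γ (Icc a b)) (ht : t ∈ Ioo a b) :
    MDifferentiableAt 𝓘(ℝ, ℝ) (𝓡 n) γ t :=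
  (hγ.contMDiffAt (Icc_mem_nhds ht.1 ht.2)).mdifferentiableAt one_ne_zero

lemma formSpeed_fst_le (hF : IsSpacelikeImmersion gM F) (hν : IsFutureUnitNormal gM F ν)
    {γ : ℝ → S} {t : ℝ} (hγ : MDifferentiableAt 𝓘(ℝ, ℝ) (𝓡 n) γ t) :
    formSpeed (metricForm gM) (fun s => (F (γ s)).1) t ≤
      (ν (γ t)).2 * formSpeed (inducedForm (-1) gM F) γ t := by
  rw [hF.formSpeed_fst_eq hγ]
  refine (Real.sqrt_le_sqrt (hν.inner_pushVec_le _ _)).trans_eq ?_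
  rw [Real.sqrt_mul (sq_nonneg _), Real.sqrt_sq (hν.snd_pos _).le]
  rfl

lemma formSpeed_one_le (hF : IsSpacelikeImmersion gM F) (hν : IsFutureUnitNormal gM F ν)
    {γ : ℝ → S} {t : ℝ} (hγ : MDifferentiableAt 𝓘(ℝ, ℝ) (𝓡 n) γ t) :
    formSpeed (inducedForm 1 gM F) γ t ≤
      √2 * formSpeed (metricForm gM) (fun s => (F (γ s)).1) t := by
  rw [hF.formSpeed_fst_eq hγ, ← Real.sqrt_mul zero_le_two]
  exact Real.sqrt_le_sqrt (hν.inducedForm_one_le _ _)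

lemma formSpeed_neg_one_le (hF : IsSpacelikeImmersion gM F)
    {γ : ℝ → S} {t : ℝ} (hγ : MDifferentiableAt 𝓘(ℝ, ℝ) (𝓡 n) γ t) :
    formSpeed (inducedForm (-1) gM F) γ t ≤
      formSpeed (metricForm gM) (fun s => (F (γ s)).1) t := by
  rw [hF.formSpeed_fst_eq hγ]
  exact Real.sqrt_le_sqrt (inducedForm_neg_one_le _ _)

lemma abs_mfderiv_snd_le (hF : IsSpacelikeImmersion gM F) (hν : IsFutureUnitNormal gM F ν)
    {γ : ℝ → S} {t : ℝ} (hγ : MDifferentiableAt 𝓘(ℝ, ℝ) (𝓡 n) γ t) :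
    |deriv (fun s => (F (γ s)).2) t| ≤ formSpeed (metricForm gM) (fun s => (F (γ s)).1) t := by
  have : deriv (fun s => (F (γ s)).2) t =
      (pushVec F (γ t) (mfderiv 𝓘(ℝ, ℝ) (𝓡 n) γ t (1 : ℝ))).2 := by
    rw [← (hF.mfderiv_comp_curve hγ).2, mfderiv_eq_fderiv]
    rfl
  rw [hF.formSpeed_fst_eq hγ, this]
  exact Real.abs_le_sqrt (hν.pushVec_snd_sq_le _ _)

lemma lintegral_formSpeed_le {f g : ℝ → ℝ} {A a b : ℝ} (hA : 0 ≤ A)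
    (h : ∀ t ∈ Ioo a b, f t ≤ A * g t) :
    ∫⁻ t in Ioo a b, ENNReal.ofReal (f t) ≤
      ENNReal.ofReal A * ∫⁻ t in Ioo a b, ENNReal.ofReal (g t) := by
  rw [← lintegral_const_mul' _ _ ENNReal.ofReal_ne_top]
  refine setLIntegral_mono' measurableSet_Ioo fun t ht => ?_
  rw [← ENNReal.ofReal_mul hA]
  exact ENNReal.ofReal_le_ofReal (h t ht)

lemma IsSpacelikeImmersion.contMDiffOn_fst_comp (hF : IsSpacelikeImmersion gM F) {γ : ℝ → S}
    {s : Set ℝ} (hγ : ContMDiffOn 𝓘(ℝ, ℝ) (𝓡 n) 1 γ s) :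
    ContMDiffOn 𝓘(ℝ, ℝ) (𝓡 n) 1 (fun t => (F (γ t)).1) s :=
  (hF.fst.of_le (by simp)).comp_contMDiffOn hγ

lemma IsSpacelikeImmersion.contDiffOn_snd_comp (hF : IsSpacelikeImmersion gM F) {γ : ℝ → S}
    {s : Set ℝ} (hγ : ContMDiffOn 𝓘(ℝ, ℝ) (𝓡 n) 1 γ s) :
    ContDiffOn ℝ 1 (fun t => (F (γ t)).2) s :=
  ((hF.snd.of_le (by simp)).comp_contMDiffOn hγ).contDiffOn

/-- Where the normal is not too steep, distances in the target are controlled by lengths. -/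
lemma edist_image_le_formLength (hF : IsSpacelikeImmersion gM F) (hν : IsFutureUnitNormal gM F ν)
    {γ : ℝ → S} (hγ : ContMDiffOn 𝓘(ℝ, ℝ) (𝓡 n) 1 γ (Icc 0 1)) {C : ℝ} (hC0 : 0 ≤ C)
    (hC : ∀ t ∈ Ioo (0 : ℝ) 1, (ν (γ t)).2 ≤ C) :
    formEDist (metricForm gM) (F (γ 0)).1 (F (γ 1)).1 ≤
        ENNReal.ofReal C * formLength (inducedForm (-1) gM F) γ 0 1 ∧
      edist (F (γ 0)).2 (F (γ 1)).2 ≤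
        ENNReal.ofReal C * formLength (inducedForm (-1) gM F) γ 0 1 := by
  have hd : ∀ t ∈ Ioo (0 : ℝ) 1, formSpeed (metricForm gM) (fun s => (F (γ s)).1) t ≤
      C * formSpeed (inducedForm (-1) gM F) γ t := fun t ht =>
    (formSpeed_fst_le hF hν (mdifferentiableAt_of_mem_Ioo hγ ht)).trans
      (mul_le_mul_of_nonneg_right (hC t ht) (Real.sqrt_nonneg _))
  constructor
  · exact ((metricForm_homogeneous gM).formEDist_le zero_le_one
      (hF.contMDiffOn_fst_comp hγ)).trans (lintegral_formSpeed_le hC0 hd)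
  · rw [edist_comm, edist_eq_enorm_sub]
    refine (enorm_sub_le_lintegral_derivWithin_Icc_of_contDiffOn_Icc
      (hF.contDiffOn_snd_comp hγ) zero_le_one).trans ?_
    rw [← restrict_Ioo_eq_restrict_Icc]
    refine le_trans ?_ (lintegral_formSpeed_le hC0 hd)
    refine setLIntegral_mono' measurableSet_Ioo fun t ht => ?_
    rw [derivWithin_of_mem_nhds (Icc_mem_nhds ht.1 ht.2), Real.enorm_eq_ofReal_abs]
    exact ENNReal.ofReal_le_ofReal
      (abs_mfderiv_snd_le hF hν (mdifferentiableAt_of_mem_Ioo hγ ht))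

lemma FormHomogeneous.formEDist_le_Icc {X : Type*} [TopologicalSpace X]
    [ChartedSpace (EuclideanSpace ℝ (Fin n)) X]
    {q : ∀ x : X, TangentSpace (𝓡 n) x → TangentSpace (𝓡 n) x → ℝ} (hq : FormHomogeneous q)
    {γ : ℝ → X} (hγ : ContMDiffOn 𝓘(ℝ, ℝ) (𝓡 n) 1 γ (Icc 0 1)) {s t : ℝ} (hs : 0 ≤ s)
    (hst : s ≤ t) (ht : t ≤ 1) :
    formEDist q (γ s) (γ t) ≤ formLength q γ s t ∧ formLength q γ s t ≤ formLength q γ 0 1 :=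
  ⟨hq.formEDist_le hst (hγ.mono (Icc_subset_Icc hs ht)),
    lintegral_mono_set (Ioo_subset_Ioo hs ht)⟩

end Spacelike

/-! ### Completeness from bounds on the normal -/

section Completeness

open scoped Bundle

variable {n : ℕ} {M : Type*} [TopologicalSpace M] [ChartedSpace (EuclideanSpace ℝ (Fin n)) M]
  [IsManifold (𝓡 n) ∞ M]
  {S : Type*} [TopologicalSpace S] [ChartedSpace (EuclideanSpace ℝ (Fin n)) S]
  [IsManifold (𝓡 n) ∞ S]
  {gM : RMetric n M} {F : S → M × ℝ} {ν : ∀ x : S, TangentSpace (𝓡 n) (F x).1 × ℝ}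

/-- Continuity jointly in the point and the vector makes the speed of coordinate segments uniformly
small when their coordinate velocity is small. -/
lemma continuousOn_metric_mfderiv (gM : RMetric n M) {ψ : EuclideanSpace ℝ (Fin n) → M}
    {U : Set (EuclideanSpace ℝ (Fin n))} (hU : IsOpen U) (hψ : ContMDiffOn (𝓡 n) (𝓡 n) 1 ψ U) :
    ContinuousOn (fun p : EuclideanSpace ℝ (Fin n) × EuclideanSpace ℝ (Fin n) =>
      gM.inner (ψ p.1) (mfderiv (𝓡 n) (𝓡 n) ψ p.1 p.2) (mfderiv (𝓡 n) (𝓡 n) ψ p.1 p.2))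
      (U ×ˢ univ) := by
  let _ : Bundle.RiemannianBundle (fun x : M => TangentSpace (𝓡 n) x) := ⟨gM.toRiemannianMetric⟩
  have : IsContinuousRiemannianBundle (EuclideanSpace ℝ (Fin n))
      (fun x : M => TangentSpace (𝓡 n) x) :=
    ⟨gM.inner, gM.contMDiff.continuous, fun _ _ _ => rfl⟩
  have h1 : ContinuousOn (fun p : EuclideanSpace ℝ (Fin n) × EuclideanSpace ℝ (Fin n) =>
      (⟨p.1, p.2⟩ : TangentBundle (𝓡 n) (EuclideanSpace ℝ (Fin n)))) (U ×ˢ univ) :=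
    (tangentBundleModelSpaceHomeomorph (𝓡 n)).symm.continuous.continuousOn
  have h2 := hψ.continuousOn_tangentMapWithin le_rfl hU.uniqueMDiffOn
  have h3 := h2.comp h1 (fun p hp => hp.1)
  refine (ContinuousOn.inner_bundle h3 h3).congr fun p hp => ?_
  change _ = gM.inner _ (mfderivWithin (𝓡 n) (𝓡 n) ψ U p.1 p.2)
    (mfderivWithin (𝓡 n) (𝓡 n) ψ U p.1 p.2)
  rw [mfderivWithin_of_isOpen hU hp.1]

/-- The induced distance is continuous for the manifold topology. -/
lemma IsSpacelikeImmersion.eventually_formEDist_lt (hF : IsSpacelikeImmersion gM F) (x : S)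
    {ε : ℝ≥0∞} (hε : 0 < ε) :
    ∀ᶠ y in 𝓝 x, formEDist (inducedForm (-1) gM F) y x < ε := by
  set e := extChartAt (𝓡 n) x with he
  have htgt : IsOpen e.target := isOpen_extChartAt_target x
  have hsm : ContMDiffOn (𝓡 n) (𝓡 n) 1 e.symm e.target :=
    contMDiffOn_extChartAt_symm (n := 1) x
  have hψ : ContMDiffOn (𝓡 n) (𝓡 n) 1 (fun z => (F (e.symm z)).1) e.target :=
    (hF.fst.of_le (by simp)).comp_contMDiffOn hsm
  obtain ⟨δ, hδ0, hδ⟩ : ∃ δ : ℝ, 0 < δ ∧ ENNReal.ofReal δ < ε := by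
    obtain ⟨δ, h1, h2⟩ := ENNReal.lt_iff_exists_nnreal_btwn.1 hε
    exact ⟨δ, by exact_mod_cast h1, by simpa using h2⟩
  have hex : e x ∈ e.target := mem_extChartAt_target x
  have hc := (continuousOn_metric_mfderiv gM htgt hψ).continuousAt (x := (e x, 0))
    ((htgt.prod isOpen_univ).mem_nhds ⟨hex, mem_univ _⟩)
  -- The form vanishes on the zero vector, so by joint continuity it stays below `δ²` for points
  -- near `e x` and vectors near `0`.
  have hsmall := hc.eventually_lt_const (u := δ ^ 2) (by
    change gM.inner _ (mfderiv (𝓡 n) (𝓡 n) (fun z => (F (e.symm z)).1) (e x)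
      (0 : TangentSpace (𝓡 n) (e x))) _ < _
    rw [map_zero, map_zero]
    exact pow_pos hδ0 2)
  obtain ⟨r, hr, hball⟩ := Metric.eventually_nhds_iff.1
    (hsmall.and ((htgt.prod isOpen_univ).mem_nhds ⟨hex, mem_univ _⟩))
  have hcont : ∀ᶠ y in 𝓝 x, dist (e y) (e x) < r :=
    (continuousAt_extChartAt x).eventually (Metric.ball_mem_nhds _ hr)
  filter_upwards [hcont, extChartAt_source_mem_nhds (I := 𝓡 n) x] with y hy hys
  -- The coordinate segment from `y` to `x` has constant velocity `e x - e y`, small when `y` is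
  -- near `x`; its length will be at most `δ`.
  let L : ℝ → EuclideanSpace ℝ (Fin n) := fun t => e y + t • (e x - e y)
  have hL : ∀ t ∈ Icc (0 : ℝ) 1, dist (L t, e x - e y) (e x, (0 : EuclideanSpace ℝ (Fin n))) < r := by
    intro t ht
    rw [Prod.dist_eq, max_lt_iff]
    constructor
    · have : L t - e x = (1 - t) • (e y - e x) := by simp only [L]; module
      rw [dist_eq_norm, this, norm_smul, Real.norm_eq_abs, abs_of_nonneg (by linarith [ht.2]),
        ← dist_eq_norm]
      nlinarith [ht.1, dist_nonneg (x := e y) (y := e x)]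
    · rw [dist_zero_right, ← dist_eq_norm, dist_comm]
      exact hy
  have hLt : ∀ t ∈ Icc (0 : ℝ) 1, L t ∈ e.target := fun t ht => (hball (hL t ht)).2.1
  have hLd : ∀ t, HasDerivAt L (e x - e y) t := fun t => by
    have := ((hasDerivAt_id t).smul_const (e x - e y)).const_add (e y)
    rwa [one_smul] at this
  have hLs : ContDiff ℝ 1 L := by fun_prop
  have hγ : ContMDiffOn 𝓘(ℝ, ℝ) (𝓡 n) 1 (fun t => e.symm (L t)) (Icc 0 1) :=
    hsm.comp hLs.contMDiff.contMDiffOn hLt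
  have h01 := (inducedForm_homogeneous (-1) gM F).formEDist_le zero_le_one hγ
  have e0 : e.symm (L 0) = y := by simpa [L] using e.left_inv hys
  have e1 : e.symm (L 1) = x := by simpa [L] using e.left_inv (mem_extChartAt_source x)
  rw [e0, e1] at h01
  refine h01.trans_lt (lt_of_le_of_lt ?_ hδ)
  calc formLength (inducedForm (-1) gM F) (fun t => e.symm (L t)) 0 1
      ≤ ∫⁻ _ in Ioo (0 : ℝ) 1, ENNReal.ofReal δ := by
        refine setLIntegral_mono' measurableSet_Ioo fun t ht => ENNReal.ofReal_le_ofReal ?_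
        refine (formSpeed_neg_one_le hF (mdifferentiableAt_of_mem_Ioo hγ ht)).trans ?_
        refine (Real.sqrt_le_left hδ0.le).2 ?_
        have hb := (hball (hL t (Ioo_subset_Icc_self ht))).1.le
        have hmf : mfderiv 𝓘(ℝ, ℝ) (𝓡 n) (fun s => (F (e.symm (L s))).1) t (1 : ℝ) =
            mfderiv (𝓡 n) (𝓡 n) (fun z => (F (e.symm z)).1) (L t) (e x - e y) := by
          have h1 := mfderiv_comp t
            ((hψ.contMDiffAt (htgt.mem_nhds (hLt t (Ioo_subset_Icc_self ht)))).mdifferentiableAt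
              one_ne_zero) (hLd t).differentiableAt.mdifferentiableAt
          refine (congrArg (fun A => A (1 : ℝ)) h1).trans ?_
          have h2 : mfderiv 𝓘(ℝ, ℝ) (𝓡 n) L t (1 : ℝ) = e x - e y := by
            rw [mfderiv_eq_fderiv]
            exact (hLd t).deriv
          exact congrArg (mfderiv (𝓡 n) (𝓡 n) (fun z => (F (e.symm z)).1) (L t)) h2
        simp only [metricForm]
        rw [hmf]
        exact hb
    _ = ENNReal.ofReal δ := by simp

/-- A proper spacelike immersion in a complete product is complete as soon as the slope of its
normal is bounded on balls of radius two of the induced metric. -/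
theorem formComplete_of_normal_bound [T2Space M] (hM : FormComplete (metricForm gM))
    (hproper : IsProperMap F) (hF : IsSpacelikeImmersion gM F) (hν : IsFutureUnitNormal gM F ν)
    (hb : ∀ x : S, ∃ C : ℝ, ∀ y : S, formEDist (inducedForm (-1) gM F) x y < 2 → (ν y).2 ≤ C) :
    FormComplete (inducedForm (-1) gM F) := by
  intro u hu
  have hq := inducedForm_homogeneous (-1) gM F
  -- The tail lies within distance one of `u N`, and curves of length less than one joining two of
  -- its points stay within distance two of `u N`: hence the radius in the hypothesis.
  obtain ⟨N, hN⟩ := hu 1 one_pos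
  obtain ⟨C₀, hC₀⟩ := hb (u N)
  set C := max C₀ 1 with hCdef
  have hC1 : 0 < C := lt_max_of_lt_right one_pos
  have hC : ∀ y : S, formEDist (inducedForm (-1) gM F) (u N) y < 2 → (ν y).2 ≤ C := fun y hy =>
    (hC₀ y hy).trans (le_max_left _ _)
  have hctrl : ∀ j ≥ N, ∀ k ≥ N, ∀ ε ≤ 1, formEDist (inducedForm (-1) gM F) (u j) (u k) < ε →
      formEDist (metricForm gM) (F (u j)).1 (F (u k)).1 ≤ ENNReal.ofReal C * ε ∧
      edist (F (u j)).2 (F (u k)).2 ≤ ENNReal.ofReal C * ε := by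
    intro j hj k _ ε hε hjk
    obtain ⟨γ, h0, h1, hγ, hlt⟩ := exists_formLength_lt hjk
    have hsteep : ∀ t ∈ Ioo (0 : ℝ) 1, (ν (γ t)).2 ≤ C := by
      intro t ht
      refine hC _ ?_
      obtain ⟨h2, h3⟩ := hq.formEDist_le_Icc
        (hγ.mono (Icc_subset_Icc le_rfl le_rfl)) le_rfl ht.1.le ht.2.le
      have h4 := hq.formEDist_triangle (u N) (γ 0) (γ t)
      have h5 : formEDist (inducedForm (-1) gM F) (u N) (γ 0) < 1 := by
        rw [h0]; exact hN N le_rfl j hj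
      have h6 : formEDist (inducedForm (-1) gM F) (γ 0) (γ t) < 1 := by
        refine (h2.trans ?_).trans_lt (hlt.trans_le hε)
        exact lintegral_mono_set (Ioo_subset_Ioo le_rfl ht.2.le)
      refine h4.trans_lt ((ENNReal.add_lt_add h5 h6).trans_eq one_add_one_eq_two)
    obtain ⟨h2, h3⟩ := edist_image_le_formLength hF hν hγ hC1.le hsteep
    rw [h0, h1] at h2 h3
    exact ⟨h2.trans (mul_le_mul_right hlt.le _), h3.trans (mul_le_mul_right hlt.le _)⟩
  have hsmall : ∀ η : ℝ≥0∞, 0 < η → ∃ K : ℕ, ∀ j ≥ K, ∀ k ≥ K,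
      formEDist (metricForm gM) (F (u j)).1 (F (u k)).1 < η ∧
        edist (F (u j)).2 (F (u k)).2 < η := by
    intro η hη
    obtain ⟨δ, hδ0, hδη⟩ := ENNReal.lt_iff_exists_nnreal_btwn.1 hη
    have hδ0' : (0 : ℝ≥0∞) < δ := by exact_mod_cast hδ0
    have hCne : ENNReal.ofReal C ≠ 0 := by simpa using hC1
    set ε : ℝ≥0∞ := min 1 (δ / ENNReal.ofReal C) with hεdef
    have hε0 : 0 < ε := lt_min one_pos (ENNReal.div_pos hδ0'.ne' ENNReal.ofReal_ne_top)
    obtain ⟨K, hK⟩ := hu ε hε0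
    refine ⟨max K N, fun j hj k hk => ?_⟩
    obtain ⟨h1, h2⟩ := hctrl j (le_of_max_le_right hj) k (le_of_max_le_right hk) ε (min_le_left _ _)
      (hK j (le_of_max_le_left hj) k (le_of_max_le_left hk))
    have h3 : ENNReal.ofReal C * ε ≤ δ :=
      (mul_le_mul_right (min_le_right _ _) _).trans
        (ENNReal.mul_div_cancel hCne ENNReal.ofReal_ne_top).le
    exact ⟨(h1.trans h3).trans_lt hδη, (h2.trans h3).trans_lt hδη⟩
  obtain ⟨y, hy⟩ := hM (fun k => (F (u k)).1) fun η hη =>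
    (hsmall η hη).imp fun K hK j hj k hk => (hK j hj k hk).1
  have hy' := tendsto_nhds_of_formEDist gM hy
  obtain ⟨s, hs⟩ := cauchySeq_tendsto_of_complete (u := fun k => (F (u k)).2)
    (EMetric.cauchySeq_iff.2 fun η hη =>
      (hsmall η hη).imp fun K hK j hj k hk => (hK j hj k hk).2)
  have hlim : Tendsto (fun k => F (u k)) atTop (𝓝 (y, s)) := hy'.prodMk_nhds hs
  -- Properness pulls the limit of the images back to a cluster point `x` of the sequence itself.
  obtain ⟨x, -, hx⟩ := ((isProperMap_iff_clusterPt F).1 hproper).2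
    (ℱ := map u atTop) (y := (y, s)) (by
      rw [MapClusterPt, map_map]
      exact hlim.mapClusterPt)
  refine ⟨x, ?_⟩
  rw [ENNReal.tendsto_nhds_zero]
  intro ε hε
  obtain ⟨K, hK⟩ := hu (ε / 2) (ENNReal.half_pos hε.ne')
  -- A Cauchy sequence converges to its cluster point. This uses that induced balls around `x` are
  -- neighbourhoods in the manifold topology.
  obtain ⟨k, hk1, hk2⟩ := ((mapClusterPt_iff_frequently.1 hx _
    (hF.eventually_formEDist_lt x (ENNReal.half_pos hε.ne'))).and_eventually
    (eventually_ge_atTop K)).exists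
  filter_upwards [eventually_ge_atTop K] with j hj
  calc formEDist (inducedForm (-1) gM F) (u j) x
      ≤ formEDist (inducedForm (-1) gM F) (u j) (u k) +
        formEDist (inducedForm (-1) gM F) (u k) x := hq.formEDist_triangle _ _ _
    _ ≤ ε / 2 + ε / 2 := add_le_add (hK j hj k hk2).le hk1.le
    _ = ε := ENNReal.add_halves ε

end Completeness

/-! ### Bounds on the normal along curves of bounded length -/

section Curves

lemma FormHomogeneous.ofReal_abs_formDist_sub_le {n : ℕ} {X : Type*} [TopologicalSpace X]
    [ChartedSpace (EuclideanSpace ℝ (Fin n)) X]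
    {q : ∀ x : X, TangentSpace (𝓡 n) x → TangentSpace (𝓡 n) x → ℝ}
    (hq : FormHomogeneous q) (o x y : X) :
    ENNReal.ofReal |formDist q o y - formDist q o x| ≤ formEDist q x y := by
  by_cases h : formEDist q x y = ⊤
  · simp [h]
  · exact ENNReal.ofReal_le_of_le_toReal (hq.abs_formDist_sub_le o x y h)

/-- A function which varies at most `A` times as fast as the arc length of a curve, where the curve
has speed at most `C G(R) ℓ / A`. -/
lemma integral_inv_le_of_curve {n : ℕ} {N : Type*} [TopologicalSpace N]
    [ChartedSpace (EuclideanSpace ℝ (Fin n)) N] [IsManifold (𝓡 n) ∞ N] (gN : RMetric n N)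
    {β : ℝ → N} (hβ : ContMDiffOn 𝓘(ℝ, ℝ) (𝓡 n) 1 β (Icc 0 1)) {G R ℓ : ℝ → ℝ} {A C L : ℝ}
    (hA : 0 ≤ A) (hC : 0 ≤ C) (hL : 0 ≤ L) (hG : ContinuousOn G (Ici 0))
    (hGpos : ∀ s, 0 ≤ s → 0 < G s) (hR0 : ∀ t, 0 ≤ R t)
    (hR : ∀ s t, 0 ≤ s → s ≤ t → t ≤ 1 →
      ENNReal.ofReal |R t - R s| ≤ ENNReal.ofReal A * formLength (metricForm gN) β s t)
    (hspeed : ∀ t ∈ Ioo (0 : ℝ) 1, A * formSpeed (metricForm gN) β t ≤ C * G (R t) * ℓ t)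
    (hl : ∫⁻ t in Ioo (0 : ℝ) 1, ENNReal.ofReal (ℓ t) ≤ ENNReal.ofReal L) :
    ∫ s in (0 : ℝ)..(R 1), 1 / G s ≤ (∫ s in (0 : ℝ)..(R 0), 1 / G s) + C * L := by
  obtain ⟨w, hwc, hw0, hw⟩ := continuousOn_formSpeed gN hβ
  refine integral_inv_le_of_speed_le (w := fun t => A * w t) hC hL hG hGpos (by fun_prop)
    (fun t => mul_nonneg hA (hw0 t)) hR0 ?_ (fun t ht => by rw [hw t ht]; exact hspeed t ht) hl
  intro s hs t ht hst
  have hi : IntegrableOn w (Ioc s t) :=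
    ((hwc.mono (Icc_subset_Icc hs.1 ht.2)).integrableOn_Icc).mono_set Ioc_subset_Icc_self
  have hlen : formLength (metricForm gN) β s t = ENNReal.ofReal (∫ x in s..t, w x) := by
    rw [intervalIntegral.integral_of_le hst,
      ofReal_integral_eq_lintegral_ofReal hi (ae_of_all _ hw0), ← restrict_Ioo_eq_restrict_Ioc]
    refine setLIntegral_congr_fun measurableSet_Ioo fun x hx => ?_
    simp only [hw x ⟨hs.1.trans_lt hx.1, hx.2.trans_le ht.2⟩]
  have h1 := hR s t hs.1 hst ht.2
  have h0 : 0 ≤ ∫ x in s..t, w x := intervalIntegral.integral_nonneg hst fun x _ => hw0 x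
  rw [hlen, ← ENNReal.ofReal_mul hA, ENNReal.ofReal_le_ofReal_iff (mul_nonneg hA h0)] at h1
  rwa [intervalIntegral.integral_const_mul]

variable {n : ℕ} {M : Type*} [TopologicalSpace M] [ChartedSpace (EuclideanSpace ℝ (Fin n)) M]
  [IsManifold (𝓡 n) ∞ M]
  {S : Type*} [TopologicalSpace S] [ChartedSpace (EuclideanSpace ℝ (Fin n)) S]
  {gM : RMetric n M} {F : S → M × ℝ} {ν : ∀ x : S, TangentSpace (𝓡 n) (F x).1 × ℝ} {c : ℝ}

lemma IsTranslatingSoliton.normal_le (hF : IsTranslatingSoliton gM F ν c) {x : S} {B : ℝ}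
    (h : meanCurvature gM F ν x ≤ B) : (ν x).2 ≤ c⁻¹ * B := by
  rw [hF.meanCurvature_eq] at h
  rwa [← div_eq_inv_mul, le_div_iff₀' hF.velocity_pos]

/-- The bound on the normal in terms of the distance for `g_M + dt²`. -/
lemma IsTranslatingSoliton.normal_bound_of_euclidean_dist (hF : IsTranslatingSoliton gM F ν c)
    {o : S} {G : ℝ → ℝ} (hG : IsPrimaryBound G)
    (hH : ∀ x : S, meanCurvature gM F ν x ≤ G (formDist (inducedForm 1 gM F) o x)) (x : S) :
    ∃ C : ℝ, ∀ y : S, formEDist (inducedForm (-1) gM F) x y < 2 → (ν y).2 ≤ C := by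
  have hc := hF.velocity_pos
  -- In the increment, `√2` compares `g_E` with the horizontal part, `c⁻¹` comes from `ν_t = H / c`,
  -- and `2` is the radius of the ball.
  obtain ⟨B, hB⟩ := hG.exists_bound
    ((∫ s in (0 : ℝ)..(formDist (inducedForm 1 gM F) o x), 1 / G s) + (√2 * c⁻¹) * 2)
  refine ⟨c⁻¹ * B, fun y hy => hF.normal_le ((hH y).trans (hB _ ENNReal.toReal_nonneg ?_))⟩
  obtain ⟨γ, h0, h1, hγ, hlt⟩ := exists_formLength_lt hy
  have hq := inducedForm_homogeneous 1 gM F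
  have key := integral_inv_le_of_curve gM (hF.immersion.contMDiffOn_fst_comp hγ)
    (R := fun t => formDist (inducedForm 1 gM F) o (γ t))
    (ℓ := formSpeed (inducedForm (-1) gM F) γ)
    (Real.sqrt_nonneg 2) (by positivity : 0 ≤ √2 * c⁻¹) zero_le_two hG.cont hG.pos
    (fun t => ENNReal.toReal_nonneg) ?_ ?_ (hlt.le.trans (by simp))
  · simpa only [h0, h1] using key
  · intro s t hs hst ht
    refine (hq.ofReal_abs_formDist_sub_le o _ _).trans
      ((hq.formEDist_le_Icc hγ hs hst ht).1.trans ?_)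
    exact lintegral_formSpeed_le (Real.sqrt_nonneg 2) fun r hr =>
      formSpeed_one_le hF.immersion hF.normal
        (mdifferentiableAt_of_mem_Ioo hγ ⟨hs.trans_lt hr.1, hr.2.trans_le ht⟩)
  · intro t ht
    have h2 := formSpeed_fst_le hF.immersion hF.normal (mdifferentiableAt_of_mem_Ioo hγ ht)
    have h3 := mul_le_mul_of_nonneg_right (hF.normal_le (hH (γ t)))
      (Real.sqrt_nonneg _ : 0 ≤ formSpeed (inducedForm (-1) gM F) γ t)
    have h4 := mul_le_mul_of_nonneg_left (h2.trans h3) (Real.sqrt_nonneg 2)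
    exact h4.trans_eq (by simp only [formSpeed]; ring)

/-- The bound on the normal in terms of the distance for the induced metric. -/
lemma IsTranslatingSoliton.normal_bound_of_induced_dist (hF : IsTranslatingSoliton gM F ν c)
    {o : S} {G : ℝ → ℝ} (hG : ContinuousOn G (Ici 0))
    (hH : ∀ x : S, meanCurvature gM F ν x ≤ G (formDist (inducedForm (-1) gM F) o x)) (x : S) :
    ∃ C : ℝ, ∀ y : S, formEDist (inducedForm (-1) gM F) x y < 2 → (ν y).2 ≤ C := by
  -- On the ball the induced distance to `o` exceeds its value at `x` by at most two, so `G` is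
  -- evaluated only on a fixed compact interval.
  obtain ⟨B, hB⟩ := (isCompact_Icc (a := (0 : ℝ))
    (b := formDist (inducedForm (-1) gM F) o x + 2)).bddAbove_image (hG.mono Icc_subset_Ici_self)
  refine ⟨c⁻¹ * B, fun y hy => hF.normal_le
    ((hH y).trans (hB (mem_image_of_mem _ ⟨ENNReal.toReal_nonneg, ?_⟩)))⟩
  have h1 := (inducedForm_homogeneous (-1) gM F).abs_formDist_sub_le o x y (hy.trans_le le_top).ne
  have h2 := ENNReal.toReal_mono (by simp) hy.le
  rw [ENNReal.toReal_ofNat] at h2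
  linarith [(abs_le.1 h1).2]

/-- The bound on the normal along a curve, in terms of the distance in a manifold `N` to which the
projection of the curve can be lifted isometrically. -/
lemma IsTranslatingSoliton.integral_inv_le_of_lift (hF : IsTranslatingSoliton gM F ν c)
    {N : Type*} [TopologicalSpace N]
    [ChartedSpace (EuclideanSpace ℝ (Fin n)) N] [IsManifold (𝓡 n) ∞ N] (gN : RMetric n N)
    {β : ℝ → N} (hβ : ContMDiffOn 𝓘(ℝ, ℝ) (𝓡 n) 1 β (Icc 0 1))
    {γ : ℝ → S} (hγ : ContMDiffOn 𝓘(ℝ, ℝ) (𝓡 n) 1 γ (Icc 0 1))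
    (hβγ : ∀ t ∈ Ioo (0 : ℝ) 1, formSpeed (metricForm gN) β t =
      formSpeed (metricForm gM) (fun s => (F (γ s)).1) t)
    (hlt : formLength (inducedForm (-1) gM F) γ 0 1 < 2) {o : N} {G : ℝ → ℝ}
    (hG : IsPrimaryBound G)
    (hH : ∀ t ∈ Ioo (0 : ℝ) 1, meanCurvature gM F ν (γ t) ≤ G (formDist (metricForm gN) o (β t))) :
    ∫ s in (0 : ℝ)..(formDist (metricForm gN) o (β 1)), 1 / G s ≤
      (∫ s in (0 : ℝ)..(formDist (metricForm gN) o (β 0)), 1 / G s) + c⁻¹ * 2 := by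
  have hc := hF.velocity_pos
  have hq := metricForm_homogeneous gN
  refine integral_inv_le_of_curve gN hβ
    (R := fun t => formDist (metricForm gN) o (β t))
    (ℓ := formSpeed (inducedForm (-1) gM F) γ)
    zero_le_one (by positivity : 0 ≤ c⁻¹) zero_le_two hG.cont hG.pos
    (fun t => ENNReal.toReal_nonneg) ?_ ?_ (hlt.le.trans (by simp))
  · intro s t hs hst ht
    refine (hq.ofReal_abs_formDist_sub_le o _ _).trans
      ((hq.formEDist_le_Icc hβ hs hst ht).1.trans ?_)
    simp
  · intro t ht
    rw [one_mul, hβγ t ht]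
    have h2 := formSpeed_fst_le hF.immersion hF.normal (mdifferentiableAt_of_mem_Ioo hγ ht)
    exact h2.trans (mul_le_mul_of_nonneg_right (hF.normal_le (hH t ht)) (Real.sqrt_nonneg _))

/-- The bound on the normal in terms of the distance in `M`. -/
lemma IsTranslatingSoliton.normal_bound_of_base_dist (hF : IsTranslatingSoliton gM F ν c)
    {o : M} {G : ℝ → ℝ} (hG : IsPrimaryBound G)
    (hH : ∀ x : S, meanCurvature gM F ν x ≤ G (formDist (metricForm gM) o (F x).1)) (x : S) :
    ∃ C : ℝ, ∀ y : S, formEDist (inducedForm (-1) gM F) x y < 2 → (ν y).2 ≤ C := by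
  obtain ⟨B, hB⟩ := hG.exists_bound
    ((∫ s in (0 : ℝ)..(formDist (metricForm gM) o (F x).1), 1 / G s) + c⁻¹ * 2)
  refine ⟨c⁻¹ * B, fun y hy => hF.normal_le ((hH y).trans (hB _ ENNReal.toReal_nonneg ?_))⟩
  obtain ⟨γ, h0, h1, hγ, hlt⟩ := exists_formLength_lt hy
  have key := hF.integral_inv_le_of_lift gM (hF.immersion.contMDiffOn_fst_comp hγ) hγ
    (fun _ _ => rfl) hlt hG (fun t _ => hH (γ t))
  simpa only [h0, h1] using key

end Curves

/-! ### Metric coefficients in charts and their behaviour under local isometries -/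

section ChartMetric

open scoped Bundle

variable {n : ℕ} {M : Type*} [TopologicalSpace M] [ChartedSpace (EuclideanSpace ℝ (Fin n)) M]
  [IsManifold (𝓡 n) ∞ M]

/-- The coefficients of the metric in a chart, as a continuous bilinear form. -/
def chartMetricCLM (gM : RMetric n M) (y₀ : M) (z : EuclideanSpace ℝ (Fin n)) :
    EuclideanSpace ℝ (Fin n) →L[ℝ] EuclideanSpace ℝ (Fin n) →L[ℝ] ℝ :=
  LinearMap.toContinuousBilinearMap (LinearMap.mk₂ ℝ (chartMetric gM y₀ z)
    (fun v v' w => by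
      have h := map_add (mfderiv 𝓘(ℝ, EuclideanSpace ℝ (Fin n)) (𝓡 n)
        (extChartAt (𝓡 n) y₀).symm z) v v'
      unfold chartMetric
      exact (congrArg (fun u => gM.inner _ u _) h).trans (by rw [map_add, add_apply]; rfl))
    (fun a v w => by
      have h := map_smul (mfderiv 𝓘(ℝ, EuclideanSpace ℝ (Fin n)) (𝓡 n)
        (extChartAt (𝓡 n) y₀).symm z) a v
      unfold chartMetric
      exact (congrArg (fun u => gM.inner _ u _) h).trans (by rw [map_smul, smul_apply]; rfl))
    (fun v w w' => by
      have h := map_add (mfderiv 𝓘(ℝ, EuclideanSpace ℝ (Fin n)) (𝓡 n)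
        (extChartAt (𝓡 n) y₀).symm z) w w'
      unfold chartMetric
      exact (congrArg (fun u => gM.inner _ _ u) h).trans (by rw [map_add]; rfl))
    (fun a v w => by
      have h := map_smul (mfderiv 𝓘(ℝ, EuclideanSpace ℝ (Fin n)) (𝓡 n)
        (extChartAt (𝓡 n) y₀).symm z) a w
      unfold chartMetric
      exact (congrArg (fun u => gM.inner _ _ u) h).trans (by rw [map_smul]; rfl)))

lemma chartMetricCLM_apply (gM : RMetric n M) (y₀ : M) (z v w : EuclideanSpace ℝ (Fin n)) :
    chartMetricCLM gM y₀ z v w = chartMetric gM y₀ z v w :=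
  rfl

lemma chartMetricCLM_symm (gM : RMetric n M) (y₀ : M) (z v w : EuclideanSpace ℝ (Fin n)) :
    chartMetricCLM gM y₀ z v w = chartMetricCLM gM y₀ z w v :=
  gM.symm _ _ _

/-- The tangent space at `y₀` is identified with the model space by the preferred chart at `y₀`
itself, in which the inverse chart is the identity. -/
lemma mfderiv_extChartAt_symm_self (y₀ : M) (v : EuclideanSpace ℝ (Fin n)) :
    mfderiv 𝓘(ℝ, EuclideanSpace ℝ (Fin n)) (𝓡 n) (extChartAt (𝓡 n) y₀).symm
      (extChartAt (𝓡 n) y₀ y₀) v = v := by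
  have hd : MDifferentiableAt 𝓘(ℝ, EuclideanSpace ℝ (Fin n)) (𝓡 n) (extChartAt (𝓡 n) y₀).symm
      (extChartAt (𝓡 n) y₀ y₀) :=
    ((contMDiffOn_extChartAt_symm (n := 1) y₀).contMDiffAt
      ((isOpen_extChartAt_target y₀).mem_nhds (mem_extChartAt_target y₀))).mdifferentiableAt
      one_ne_zero
  rw [hd.mfderiv]
  have he : writtenInExtChartAt 𝓘(ℝ, EuclideanSpace ℝ (Fin n)) (𝓡 n) (extChartAt (𝓡 n) y₀ y₀)
      (extChartAt (𝓡 n) y₀).symm =ᶠ[𝓝 (extChartAt (𝓡 n) y₀ y₀)] id := by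
    filter_upwards [(isOpen_extChartAt_target (I := 𝓡 n) y₀).mem_nhds (mem_extChartAt_target y₀)]
      with z hz
    simp only [writtenInExtChartAt, extChartAt_model_space_eq_id, Function.comp_apply,
      PartialEquiv.refl_symm, PartialEquiv.refl_coe, id, extChartAt_to_inv]
    exact (extChartAt (𝓡 n) y₀).right_inv hz
  simp only [modelWithCornersSelf_coe, range_id, fderivWithin_univ, extChartAt_model_space_eq_id,
    PartialEquiv.refl_coe, id]
  rw [he.fderiv_eq, fderiv_id]
  rfl

lemma chartMetricCLM_self (gM : RMetric n M) (y₀ : M) (v w : EuclideanSpace ℝ (Fin n)) :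
    chartMetricCLM gM y₀ (extChartAt (𝓡 n) y₀ y₀) v w = gM.inner y₀ v w := by
  rw [chartMetricCLM_apply, chartMetric, mfderiv_extChartAt_symm_self,
    mfderiv_extChartAt_symm_self]
  -- The base point is `y₀` only up to a propositional equality, so it is generalized before
  -- substitution.
  have : ∀ y : M, y = y₀ → (gM.inner y : EuclideanSpace ℝ (Fin n) →L[ℝ] _) v w =
      (gM.inner y₀ : EuclideanSpace ℝ (Fin n) →L[ℝ] _) v w := by
    rintro y rfl
    rfl
  exact this _ (extChartAt_to_inv y₀)

/-- In finite dimension it suffices to test on constant coordinate vectors; the inverse chart maps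
these to smooth fields, on which the metric is smooth. -/
lemma differentiableAt_chartMetricCLM (gM : RMetric n M) (y₀ : M) :
    DifferentiableAt ℝ (chartMetricCLM gM y₀) (extChartAt (𝓡 n) y₀ y₀) := by
  let _ : Bundle.RiemannianBundle (fun x : M => TangentSpace (𝓡 n) x) := ⟨gM.toRiemannianMetric⟩
  have : IsContMDiffRiemannianBundle (𝓡 n) ∞ (EuclideanSpace ℝ (Fin n))
      (fun x : M => TangentSpace (𝓡 n) x) :=
    ⟨gM.inner, gM.contMDiff, fun _ _ _ => rfl⟩
  have htgt : IsOpen (extChartAt (𝓡 n) y₀).target := isOpen_extChartAt_target y₀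
  have h1 : ∀ v : EuclideanSpace ℝ (Fin n),
      ContMDiff (𝓡 n) (𝓡 n).tangent ∞ fun z : EuclideanSpace ℝ (Fin n) =>
      (⟨z, v⟩ : TangentBundle (𝓡 n) (EuclideanSpace ℝ (Fin n))) := fun v =>
    contMDiff_vectorSpace_iff_contDiff.2 contDiff_const
  have h2 := (contMDiffOn_extChartAt_symm (n := ∞) (I := 𝓡 n) y₀).contMDiffOn_tangentMapWithin
    (m := ∞) (by simp) htgt.uniqueMDiffOn
  have h3 : ∀ v, _ := fun v => h2.comp ((h1 v).contMDiffOn (s := (extChartAt (𝓡 n) y₀).target))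
    (fun p hp => hp)
  have h4 : ContDiffOn ℝ ∞ (chartMetricCLM gM y₀) (extChartAt (𝓡 n) y₀).target := by
    refine contDiffOn_clm_apply.2 fun v => contDiffOn_clm_apply.2 fun w => ?_
    refine (ContMDiffOn.inner_bundle (h3 v) (h3 w)).contDiffOn.congr fun z hz => ?_
    change _ = gM.inner _ (mfderivWithin (𝓡 n) (𝓡 n) _ _ _ _)
      (mfderivWithin (𝓡 n) (𝓡 n) _ _ _ _)
    rw [mfderivWithin_of_isOpen htgt hz]
    rfl
  exact (h4.contDiffAt (htgt.mem_nhds (mem_extChartAt_target y₀))).differentiableAt (by simp)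

end ChartMetric

/-! ### Change of the Christoffel symbols under a local isometry -/

section ChristoffelTransformation

variable {n : ℕ}

/-- The derivative of a metric tensor pulled back by `ρ`. -/
lemma fderiv_pullback_form {E : Type*} [NormedAddCommGroup E] [NormedSpace ℝ E]
    {K K' : E → E →L[ℝ] E →L[ℝ] ℝ} {ρ : E → E} {z₀ : E}
    (hK : DifferentiableAt ℝ K (ρ z₀)) (hK' : DifferentiableAt ℝ K' z₀) (hρ : ContDiffAt ℝ ∞ ρ z₀)
    (h : ∀ᶠ z in 𝓝 z₀, ∀ v w, K' z v w = K (ρ z) (fderiv ℝ ρ z v) (fderiv ℝ ρ z w)) (u v w : E) :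
    fderiv ℝ K' z₀ u v w =
      fderiv ℝ K (ρ z₀) (fderiv ℝ ρ z₀ u) (fderiv ℝ ρ z₀ v) (fderiv ℝ ρ z₀ w) +
      K (ρ z₀) (fderiv ℝ (fderiv ℝ ρ) z₀ u v) (fderiv ℝ ρ z₀ w) +
      K (ρ z₀) (fderiv ℝ ρ z₀ v) (fderiv ℝ (fderiv ℝ ρ) z₀ u w) := by
  have hρd : HasFDerivAt ρ (fderiv ℝ ρ z₀) z₀ := (hρ.differentiableAt (by simp)).hasFDerivAt
  have hρ2 : HasFDerivAt (fderiv ℝ ρ) (fderiv ℝ (fderiv ℝ ρ) z₀) z₀ :=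
    ((hρ.fderiv_right (m := 1) (by norm_cast)).differentiableAt one_ne_zero).hasFDerivAt
  have e1 : HasFDerivAt (fun z => K' z v w) _ z₀ :=
    (hK'.hasFDerivAt.clm_apply (hasFDerivAt_const v z₀)).clm_apply (hasFDerivAt_const w z₀)
  have e2 : HasFDerivAt (fun z => K (ρ z) (fderiv ℝ ρ z v) (fderiv ℝ ρ z w)) _ z₀ :=
    ((hK.hasFDerivAt.comp z₀ hρd).clm_apply (hρ2.clm_apply (hasFDerivAt_const v z₀))).clm_apply
      (hρ2.clm_apply (hasFDerivAt_const w z₀))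
  have e3 : (fun z => K' z v w) =ᶠ[𝓝 z₀] fun z => K (ρ z) (fderiv ℝ ρ z v) (fderiv ℝ ρ z w) :=
    h.mono fun z hz => hz v w
  have e4 := (e1.unique (e2.congr_of_eventuallyEq e3))
  have e5 := congrArg (fun A => A u) e4
  simp at e5
  rw [e5]
  ring

variable {M : Type*} [TopologicalSpace M] [ChartedSpace (EuclideanSpace ℝ (Fin n)) M]
  [IsManifold (𝓡 n) ∞ M]

/-- Differentiating the tensor as a whole, instead of each coefficient, makes the trilinearity of
the symbols visible. -/
lemma christoffelFirst_eq (gM : RMetric n M) (y : M) (u v w : EuclideanSpace ℝ (Fin n)) :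
    christoffelFirst gM y u v w =
      (fderiv ℝ (chartMetricCLM gM y) (extChartAt (𝓡 n) y y) u v w +
        fderiv ℝ (chartMetricCLM gM y) (extChartAt (𝓡 n) y y) v u w -
        fderiv ℝ (chartMetricCLM gM y) (extChartAt (𝓡 n) y y) w u v) / 2 := by
  have key : ∀ u v w : EuclideanSpace ℝ (Fin n),
      fderiv ℝ (fun z => chartMetricCLM gM y z v w) (extChartAt (𝓡 n) y y) u =
        fderiv ℝ (chartMetricCLM gM y) (extChartAt (𝓡 n) y y) u v w := by
    intro u v w
    have e1 : HasFDerivAt (fun z => chartMetricCLM gM y z v w) _ (extChartAt (𝓡 n) y y) :=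
      ((differentiableAt_chartMetricCLM gM y).hasFDerivAt.clm_apply
        (hasFDerivAt_const v _)).clm_apply (hasFDerivAt_const w _)
    have e2 := congrArg (fun A => A u) e1.fderiv
    simpa using e2
  simp only [christoffelFirst, ← chartMetricCLM_apply, key]

lemma ContMDiffAt.contDiffAt_writtenInExtChartAt {X : Type*} [TopologicalSpace X]
    [ChartedSpace (EuclideanSpace ℝ (Fin n)) X] {E' H' Y : Type*} [NormedAddCommGroup E']
    [NormedSpace ℝ E'] [TopologicalSpace H'] {I' : ModelWithCorners ℝ E' H'} [TopologicalSpace Y]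
    [ChartedSpace H' Y] {f : X → Y} {x : X} (hf : ContMDiffAt (𝓡 n) I' ∞ f x) :
    ContDiffAt ℝ ∞ (writtenInExtChartAt (𝓡 n) I' x f) (extChartAt (𝓡 n) x x) := by
  have := (contMDiffAt_iff.1 hf).2
  rwa [modelWithCornersSelf_coe, range_id, contDiffWithinAt_univ] at this

lemma ContMDiffAt.mfderiv_eq_fderiv_written {X : Type*} [TopologicalSpace X]
    [ChartedSpace (EuclideanSpace ℝ (Fin n)) X] {E' H' Y : Type*} [NormedAddCommGroup E']
    [NormedSpace ℝ E'] [TopologicalSpace H'] {I' : ModelWithCorners ℝ E' H'} [TopologicalSpace Y]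
    [ChartedSpace H' Y] {f : X → Y} {x : X} (hf : ContMDiffAt (𝓡 n) I' ∞ f x)
    (v : EuclideanSpace ℝ (Fin n)) :
    mfderiv (𝓡 n) I' f x v =
      fderiv ℝ (writtenInExtChartAt (𝓡 n) I' x f) (extChartAt (𝓡 n) x x) v := by
  rw [(hf.mdifferentiableAt (by simp)).mfderiv]
  simp only [modelWithCornersSelf_coe, range_id, fderivWithin_univ]
  rfl

variable {M' : Type*} [TopologicalSpace M'] [ChartedSpace (EuclideanSpace ℝ (Fin n)) M']
  [IsManifold (𝓡 n) ∞ M']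

/-- The expression of the pulled back metric in the preferred charts. -/
lemma eventually_chartMetricCLM_pullback (gM : RMetric n M) (g' : RMetric n M') {p : M' → M}
    (hp : ContMDiff (𝓡 n) (𝓡 n) ∞ p)
    (hpull : ∀ (y : M') (v w : TangentSpace (𝓡 n) y),
      g'.inner y v w = gM.inner (p y) (mfderiv (𝓡 n) (𝓡 n) p y v) (mfderiv (𝓡 n) (𝓡 n) p y w))
    (y : M') :
    ∀ᶠ z in 𝓝 (extChartAt (𝓡 n) y y), ∀ v w,
      chartMetricCLM g' y z v w =
        chartMetricCLM gM (p y) (writtenInExtChartAt (𝓡 n) (𝓡 n) y p z)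
          (fderiv ℝ (writtenInExtChartAt (𝓡 n) (𝓡 n) y p) z v)
          (fderiv ℝ (writtenInExtChartAt (𝓡 n) (𝓡 n) y p) z w) := by
  set a := extChartAt (𝓡 n) y with ha
  set b := extChartAt (𝓡 n) (p y) with hb
  set ρ := writtenInExtChartAt (𝓡 n) (𝓡 n) y p with hρ
  have hat : IsOpen a.target := isOpen_extChartAt_target y
  have hbt : IsOpen b.target := isOpen_extChartAt_target (p y)
  have has : ContMDiffOn (𝓡 n) (𝓡 n) ∞ a.symm a.target := contMDiffOn_extChartAt_symm y
  have hbs : ContMDiffOn (𝓡 n) (𝓡 n) ∞ b.symm b.target := contMDiffOn_extChartAt_symm (p y)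
  have hcont : ContinuousAt (fun z => p (a.symm z)) (a y) :=
    hp.continuous.continuousAt.comp (continuousAt_extChartAt_symm y)
  have hsrc : ∀ᶠ z in 𝓝 (a y), p (a.symm z) ∈ b.source := by
    refine hcont.eventually ?_
    simp only [ha, extChartAt_to_inv]
    exact extChartAt_source_mem_nhds (p y)
  have hρs : ∀ᶠ z in 𝓝 (a y), ContDiffAt ℝ 1 ρ z :=
    ((hp y).contDiffAt_writtenInExtChartAt.of_le (m := 1) (by simp)).eventually (by simp)
  filter_upwards [hsrc.eventually_nhds, hρs, hat.mem_nhds (mem_extChartAt_target y)]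
    with z hz hρz hzt v w
  have hpz : p (a.symm z) = b.symm (ρ z) := (b.left_inv hz.self_of_nhds).symm
  have hev : (fun z => p (a.symm z)) =ᶠ[𝓝 z] fun z => b.symm (ρ z) :=
    hz.mono fun z hz => (b.left_inv hz).symm
  have hmaps : ρ z ∈ b.target := b.map_source hz.self_of_nhds
  have h1 : ∀ v : EuclideanSpace ℝ (Fin n),
      (mfderiv (𝓡 n) (𝓡 n) p (a.symm z) (mfderiv (𝓡 n) (𝓡 n) a.symm z v) :
        EuclideanSpace ℝ (Fin n)) = mfderiv (𝓡 n) (𝓡 n) b.symm (ρ z) (fderiv ℝ ρ z v) := by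
    intro v
    have e1 := mfderiv_comp z ((hp (a.symm z)).mdifferentiableAt (by simp))
      ((has.contMDiffAt (hat.mem_nhds hzt)).mdifferentiableAt (by simp))
    have e2 := mfderiv_comp z
      ((hbs.contMDiffAt (hbt.mem_nhds hmaps)).mdifferentiableAt (by simp))
      (hρz.differentiableAt one_ne_zero).mdifferentiableAt
    have e3 := hev.mfderiv_eq (I := 𝓡 n) (I' := 𝓡 n)
    rw [mfderiv_eq_fderiv] at e2
    have e4 := congrArg (fun A : EuclideanSpace ℝ (Fin n) →L[ℝ] EuclideanSpace ℝ (Fin n) => A v) e1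
    have e5 := congrArg (fun A : EuclideanSpace ℝ (Fin n) →L[ℝ] EuclideanSpace ℝ (Fin n) => A v) e2
    have e6 := congrArg (fun A : EuclideanSpace ℝ (Fin n) →L[ℝ] EuclideanSpace ℝ (Fin n) => A v) e3
    exact e4.symm.trans (e6.trans e5)
  rw [chartMetricCLM_apply, chartMetricCLM_apply, chartMetric, chartMetric, hpull]
  have h2 : ∀ (q q' : M) (_ : q = q') (v v' w w' : EuclideanSpace ℝ (Fin n)), v = v' → w = w' →
      gM.inner q v w = gM.inner q' v' w' := by
    rintro q _ rfl v _ w _ rfl rfl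
    rfl
  exact h2 _ _ hpz _ _ _ _ (h1 v) (h1 w)

/-- The transformation law of the Christoffel symbols under a local isometry. -/
lemma christoffelFirst_pullback (gM : RMetric n M) (g' : RMetric n M') {p : M' → M}
    (hp : ContMDiff (𝓡 n) (𝓡 n) ∞ p)
    (hpull : ∀ (y : M') (v w : TangentSpace (𝓡 n) y),
      g'.inner y v w = gM.inner (p y) (mfderiv (𝓡 n) (𝓡 n) p y v) (mfderiv (𝓡 n) (𝓡 n) p y w))
    (y : M') (u v w : EuclideanSpace ℝ (Fin n)) :
    let D := fderiv ℝ (writtenInExtChartAt (𝓡 n) (𝓡 n) y p)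
    let z := extChartAt (𝓡 n) y y
    christoffelFirst g' y u v w =
      christoffelFirst gM (p y) (D z u) (D z v) (D z w) +
        chartMetricCLM gM (p y) (extChartAt (𝓡 n) (p y) (p y)) (fderiv ℝ D z u v) (D z w) := by
  intro D z
  set ρ := writtenInExtChartAt (𝓡 n) (𝓡 n) y p with hρ
  have hρz : ρ z = extChartAt (𝓡 n) (p y) (p y) := by
    simp [ρ, z, writtenInExtChartAt]
  have hsm : ContDiffAt ℝ ∞ ρ z := (hp y).contDiffAt_writtenInExtChartAt
  have hsymm : ∀ u v, fderiv ℝ D z u v = fderiv ℝ D z v u := fun u v =>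
    (hsm.isSymmSndFDerivAt (by simpa using ENat.LEInfty.out)).eq u v
  have key := fderiv_pullback_form
    (by rw [hρz]; exact differentiableAt_chartMetricCLM gM (p y))
    (differentiableAt_chartMetricCLM g' y) hsm
    (eventually_chartMetricCLM_pullback gM g' hp hpull y)
  rw [hρz] at key
  -- Each `key` contributes two terms containing `D²ρ`. By the symmetry of `D²ρ` and of the metric
  -- four of the six cancel, and the other two are equal, which removes the factor one half.
  rw [christoffelFirst_eq, christoffelFirst_eq, key, key, key]
  have s1 := hsymm v u
  have s2 := hsymm w u
  have s3 := hsymm w v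
  simp only [D, z] at s1 s2 s3 ⊢
  rw [s1, s2, s3, chartMetricCLM_symm gM (p y) _ (fderiv ℝ ρ _ v),
    chartMetricCLM_symm gM (p y) _ (fderiv ℝ ρ _ u)]
  ring

end ChristoffelTransformation

/-! ### Naturality of the second fundamental form -/

section Naturality

variable {n : ℕ}

lemma fderiv_fderiv_comp {E W : Type*} [NormedAddCommGroup E] [NormedSpace ℝ E]
    [NormedAddCommGroup W] [NormedSpace ℝ W] {f : E → W} {g : E → E} {z₀ : E}
    (hf : ContDiffAt ℝ ∞ f (g z₀)) (hg : ContDiffAt ℝ ∞ g z₀) (v w : E) :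
    fderiv ℝ (fderiv ℝ (f ∘ g)) z₀ v w =
      fderiv ℝ (fderiv ℝ f) (g z₀) (fderiv ℝ g z₀ v) (fderiv ℝ g z₀ w) +
        fderiv ℝ f (g z₀) (fderiv ℝ (fderiv ℝ g) z₀ v w) := by
  have hf1 : ∀ᶠ y in 𝓝 (g z₀), ContDiffAt ℝ 1 f y :=
    (hf.of_le (m := 1) (by simp)).eventually (by simp)
  have hg1 : ∀ᶠ z in 𝓝 z₀, ContDiffAt ℝ 1 g z :=
    (hg.of_le (m := 1) (by simp)).eventually (by simp)
  have hev : fderiv ℝ (f ∘ g) =ᶠ[𝓝 z₀] fun z => (fderiv ℝ f (g z)).comp (fderiv ℝ g z) := by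
    filter_upwards [hg.continuousAt.eventually hf1, hg1] with z h1 h2
    exact fderiv_comp z (h1.differentiableAt one_ne_zero) (h2.differentiableAt one_ne_zero)
  have hgd : HasFDerivAt g (fderiv ℝ g z₀) z₀ := (hg.differentiableAt (by simp)).hasFDerivAt
  have hg2 : HasFDerivAt (fderiv ℝ g) (fderiv ℝ (fderiv ℝ g) z₀) z₀ :=
    ((hg.fderiv_right (m := 1) (by norm_cast)).differentiableAt one_ne_zero).hasFDerivAt
  have hf2 : HasFDerivAt (fderiv ℝ f) (fderiv ℝ (fderiv ℝ f) (g z₀)) (g z₀) :=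
    ((hf.fderiv_right (m := 1) (by norm_cast)).differentiableAt one_ne_zero).hasFDerivAt
  have e := (hf2.comp z₀ hgd).clm_comp hg2
  have e' := (e.congr_of_eventuallyEq hev).fderiv
  have e'' := congrArg (fun A => A v w) e'
  simp at e''
  rw [e'', add_comm]

variable {M : Type*} [TopologicalSpace M] [ChartedSpace (EuclideanSpace ℝ (Fin n)) M]
  [IsManifold (𝓡 n) ∞ M]
  {S : Type*} [TopologicalSpace S] [ChartedSpace (EuclideanSpace ℝ (Fin n)) S]
  {M' : Type*} [TopologicalSpace M'] [ChartedSpace (EuclideanSpace ℝ (Fin n)) M']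
  [IsManifold (𝓡 n) ∞ M']
  {S' : Type*} [TopologicalSpace S'] [ChartedSpace (EuclideanSpace ℝ (Fin n)) S']
  {gM : RMetric n M} {F : S → M × ℝ} {g' : RMetric n M'} {F' : S' → M' × ℝ}
  {p : M' → M} {π : S' → S}

/-- The base points of `F ∘ π` and `p ∘ F'` are only propositionally equal; stating the arguments in
the model space allows transport between them. -/
lemma productForm_congr (ε : ℝ) (gM : RMetric n M) {y y' : M} (h : y = y')
    (V W : EuclideanSpace ℝ (Fin n) × ℝ) :
    productForm ε gM y V W = productForm ε gM y' V W := by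
  subst h; rfl

lemma christoffelFirst_congr (gM : RMetric n M) {y y' : M} (h : y = y')
    {u u' v v' w w' : EuclideanSpace ℝ (Fin n)} (hu : u = u') (hv : v = v') (hw : w = w') :
    christoffelFirst gM y u v w = christoffelFirst gM y' u' v' w' := by
  subst h hu hv hw; rfl

lemma pushVec_fst_lift (hp : ContMDiff (𝓡 n) (𝓡 n) ∞ p) (hπ : ContMDiff (𝓡 n) (𝓡 n) ∞ π)
    (hF : ContMDiff (𝓡 n) ((𝓡 n).prod 𝓘(ℝ, ℝ)) ∞ F)
    (hF' : ContMDiff (𝓡 n) ((𝓡 n).prod 𝓘(ℝ, ℝ)) ∞ F')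
    (hcomm : ∀ x : S', (p (F' x).1, (F' x).2) = F (π x)) (x : S') (v : EuclideanSpace ℝ (Fin n)) :
    ((pushVec F (π x) (mfderiv (𝓡 n) (𝓡 n) π x v)).1 : EuclideanSpace ℝ (Fin n)) =
      mfderiv (𝓡 n) (𝓡 n) p (F' x).1 (pushVec F' x v).1 := by
  have e1 := mfderiv_comp x (hF.fst.mdifferentiableAt (by simp) (x := π x))
    (hπ.mdifferentiableAt (by simp))
  have e2 := mfderiv_comp x (hp.mdifferentiableAt (by simp) (x := (F' x).1))
    (hF'.fst.mdifferentiableAt (by simp))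
  have e3 : ((fun q => (F q).1) ∘ π) = p ∘ fun q => (F' q).1 :=
    funext fun q => (congrArg Prod.fst (hcomm q)).symm
  have e4 : ∀ f g : S' → M, f = g → (mfderiv (𝓡 n) (𝓡 n) f x v : EuclideanSpace ℝ (Fin n)) =
      mfderiv (𝓡 n) (𝓡 n) g x v := by
    rintro f _ rfl; rfl
  have e5 := congrArg (fun A : EuclideanSpace ℝ (Fin n) →L[ℝ] EuclideanSpace ℝ (Fin n) => A v) e1
  have e6 := congrArg (fun A : EuclideanSpace ℝ (Fin n) →L[ℝ] EuclideanSpace ℝ (Fin n) => A v) e2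
  exact e5.symm.trans ((e4 _ _ e3).trans e6)

lemma pushVec_snd_lift (hπ : ContMDiff (𝓡 n) (𝓡 n) ∞ π)
    (hF : ContMDiff (𝓡 n) ((𝓡 n).prod 𝓘(ℝ, ℝ)) ∞ F)
    (hcomm : ∀ x : S', (p (F' x).1, (F' x).2) = F (π x)) (x : S') (v : EuclideanSpace ℝ (Fin n)) :
    (pushVec F (π x) (mfderiv (𝓡 n) (𝓡 n) π x v)).2 = (pushVec F' x v).2 := by
  have e1 := mfderiv_comp x (hF.snd.mdifferentiableAt (by simp) (x := π x))
    (hπ.mdifferentiableAt (by simp))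
  have e3 : ((fun q => (F q).2) ∘ π) = fun q => (F' q).2 :=
    funext fun q => (congrArg Prod.snd (hcomm q)).symm
  have e4 : ∀ f g : S' → ℝ, f = g → (mfderiv (𝓡 n) 𝓘(ℝ, ℝ) f x v : ℝ) =
      mfderiv (𝓡 n) 𝓘(ℝ, ℝ) g x v := by
    rintro f _ rfl; rfl
  have e5 := congrArg (fun A : EuclideanSpace ℝ (Fin n) →L[ℝ] ℝ => A v) e1
  exact e5.symm.trans (e4 _ _ e3)

lemma productForm_lift (ε : ℝ)
    (hpull : ∀ (y : M') (v w : TangentSpace (𝓡 n) y),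
      g'.inner y v w = gM.inner (p y) (mfderiv (𝓡 n) (𝓡 n) p y v) (mfderiv (𝓡 n) (𝓡 n) p y w))
    (y : M') (V W : TangentSpace (𝓡 n) y × ℝ) :
    productForm ε g' y V W = productForm ε gM (p y) (mfderiv (𝓡 n) (𝓡 n) p y V.1, V.2)
      (mfderiv (𝓡 n) (𝓡 n) p y W.1, W.2) := by
  simp only [productForm, hpull]

/-- The covariant derivative along the lift, up to a tangential term. -/
lemma covDerivPairing_lift (hp : ContMDiff (𝓡 n) (𝓡 n) ∞ p) (hπ : ContMDiff (𝓡 n) (𝓡 n) ∞ π)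
    (hF : ContMDiff (𝓡 n) ((𝓡 n).prod 𝓘(ℝ, ℝ)) ∞ F)
    (hF' : ContMDiff (𝓡 n) ((𝓡 n).prod 𝓘(ℝ, ℝ)) ∞ F')
    (hcomm : ∀ x : S', (p (F' x).1, (F' x).2) = F (π x))
    (hpull : ∀ (y : M') (v w : TangentSpace (𝓡 n) y),
      g'.inner y v w = gM.inner (p y) (mfderiv (𝓡 n) (𝓡 n) p y v) (mfderiv (𝓡 n) (𝓡 n) p y w))
    (x : S') (v w : EuclideanSpace ℝ (Fin n)) (ξ : EuclideanSpace ℝ (Fin n) × ℝ)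
    (η : EuclideanSpace ℝ (Fin n) × ℝ) (hη1 : η.1 = mfderiv (𝓡 n) (𝓡 n) p (F' x).1 ξ.1)
    (hη2 : η.2 = ξ.2) :
    covDerivPairing g' F' x v w ξ =
      covDerivPairing gM F (π x) (mfderiv (𝓡 n) (𝓡 n) π x v) (mfderiv (𝓡 n) (𝓡 n) π x w) η +
      productForm (-1) gM (F (π x)).1 (pushVec F (π x)
        (fderiv ℝ (fderiv ℝ (writtenInExtChartAt (𝓡 n) (𝓡 n) x π)) (extChartAt (𝓡 n) x x) v w))
        η := by
  have hy : (F (π x)).1 = p (F' x).1 := (congrArg Prod.fst (hcomm x)).symm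
  set z := extChartAt (𝓡 n) x x with hz
  set σ := writtenInExtChartAt (𝓡 n) (𝓡 n) x π with hσ
  set ρ := writtenInExtChartAt (𝓡 n) (𝓡 n) (F' x).1 p with hρ
  set Φ' := writtenInExtChartAt (𝓡 n) (𝓡 n) x (fun q => (F' q).1) with hΦ'
  set Φ := writtenInExtChartAt (𝓡 n) (𝓡 n) (π x) (fun q => (F q).1) with hΦ
  set h' := writtenInExtChartAt (𝓡 n) 𝓘(ℝ, ℝ) x (fun q => (F' q).2) with hh'
  set h := writtenInExtChartAt (𝓡 n) 𝓘(ℝ, ℝ) (π x) (fun q => (F q).2) with hh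
  have cσ : ContDiffAt ℝ ∞ σ z := (hπ x).contDiffAt_writtenInExtChartAt
  have cΦ' : ContDiffAt ℝ ∞ Φ' z := (hF'.fst x).contDiffAt_writtenInExtChartAt
  have zσ : σ z = extChartAt (𝓡 n) (π x) (π x) := by simp [σ, z, writtenInExtChartAt]
  have zΦ' : Φ' z = extChartAt (𝓡 n) (F' x).1 (F' x).1 := by simp [Φ', z, writtenInExtChartAt]
  have cΦ : ContDiffAt ℝ ∞ Φ (σ z) := by
    rw [zσ]; exact (hF.fst (π x)).contDiffAt_writtenInExtChartAt
  have ch : ContDiffAt ℝ ∞ h (σ z) := by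
    rw [zσ]; exact (hF.snd (π x)).contDiffAt_writtenInExtChartAt
  have cρ : ContDiffAt ℝ ∞ ρ (Φ' z) := by
    rw [zΦ']; exact (hp (F' x).1).contDiffAt_writtenInExtChartAt
  have src1 : ∀ᶠ ζ in 𝓝 z, π ((extChartAt (𝓡 n) x).symm ζ) ∈ (extChartAt (𝓡 n) (π x)).source := by
    refine (hπ.continuous.continuousAt.comp (continuousAt_extChartAt_symm x)).eventually ?_
    simp only [Function.comp_apply, extChartAt_to_inv]
    exact extChartAt_source_mem_nhds (π x)
  have src2 : ∀ᶠ ζ in 𝓝 z,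
      (F' ((extChartAt (𝓡 n) x).symm ζ)).1 ∈ (extChartAt (𝓡 n) (F' x).1).source := by
    refine (hF'.fst.continuous.continuousAt.comp (continuousAt_extChartAt_symm x)).eventually ?_
    simp only [Function.comp_apply, extChartAt_to_inv]
    exact extChartAt_source_mem_nhds (F' x).1
  -- The relation `p ∘ F' = F ∘ π` in charts; differentiating it twice compares the two Hessians.
  have ev1 : ρ ∘ Φ' =ᶠ[𝓝 z] Φ ∘ σ := by
    filter_upwards [src1, src2] with ζ h1 h2
    simp only [ρ, Φ', Φ, σ, writtenInExtChartAt, Function.comp_apply, PartialEquiv.left_inv _ h1,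
      PartialEquiv.left_inv _ h2, ← hcomm]
  have ev2 : h' =ᶠ[𝓝 z] h ∘ σ := by
    filter_upwards [src1] with ζ h1
    simp only [h', h, σ, writtenInExtChartAt, Function.comp_apply, PartialEquiv.left_inv _ h1,
      ← hcomm]
  have d1 : fderiv ℝ (fderiv ℝ (ρ ∘ Φ')) z v w = fderiv ℝ (fderiv ℝ (Φ ∘ σ)) z v w := by
    rw [(ev1.fderiv (𝕜 := ℝ)).fderiv_eq]
  have d2 : fderiv ℝ (fderiv ℝ h') z v w = fderiv ℝ (fderiv ℝ (h ∘ σ)) z v w := by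
    rw [(ev2.fderiv (𝕜 := ℝ)).fderiv_eq]
  rw [fderiv_fderiv_comp cρ cΦ', fderiv_fderiv_comp cΦ cσ] at d1
  rw [fderiv_fderiv_comp ch cσ] at d2
  have hpush1 : ∀ u : EuclideanSpace ℝ (Fin n),
      ((pushVec F (π x) u).1 : EuclideanSpace ℝ (Fin n)) = fderiv ℝ Φ (σ z) u := fun u => by
    rw [zσ]; exact (hF.fst (π x)).mfderiv_eq_fderiv_written u
  have hpush2 : ∀ u : EuclideanSpace ℝ (Fin n),
      (pushVec F (π x) u).2 = fderiv ℝ h (σ z) u := fun u => by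
    rw [zσ]; exact (hF.snd (π x)).mfderiv_eq_fderiv_written u
  have hpush' : ∀ u : EuclideanSpace ℝ (Fin n),
      ((pushVec F' x u).1 : EuclideanSpace ℝ (Fin n)) = fderiv ℝ Φ' z u := fun u =>
    (hF'.fst x).mfderiv_eq_fderiv_written u
  have hL : ∀ u : EuclideanSpace ℝ (Fin n),
      (mfderiv (𝓡 n) (𝓡 n) p (F' x).1 u : EuclideanSpace ℝ (Fin n)) = fderiv ℝ ρ (Φ' z) u :=
    fun u => by rw [zΦ']; exact (hp (F' x).1).mfderiv_eq_fderiv_written u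
  have hP : ∀ u : EuclideanSpace ℝ (Fin n),
      (mfderiv (𝓡 n) (𝓡 n) π x u : EuclideanSpace ℝ (Fin n)) = fderiv ℝ σ z u := fun u =>
    (hπ x).mfderiv_eq_fderiv_written u
  have hchain : ∀ u, fderiv ℝ ρ (Φ' z) (fderiv ℝ Φ' z u) = fderiv ℝ Φ (σ z) (fderiv ℝ σ z u) := by
    intro u
    have e : fderiv ℝ (ρ ∘ Φ') z u = fderiv ℝ (Φ ∘ σ) z u := by rw [ev1.fderiv_eq]
    rw [fderiv_comp z (cρ.differentiableAt (by simp)) (cΦ'.differentiableAt (by simp)),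
      fderiv_comp z (cΦ.differentiableAt (by simp)) (cσ.differentiableAt (by simp))] at e
    exact e
  have hη1' : η.1 = fderiv ℝ ρ (Φ' z) ξ.1 := hη1.trans (hL _)
  set K := chartMetricCLM gM (p (F' x).1) (extChartAt (𝓡 n) (p (F' x).1) (p (F' x).1)) with hK
  have hmet : ∀ q : M, q = p (F' x).1 → ∀ a b : EuclideanSpace ℝ (Fin n),
      gM.inner q a b = K a b := by
    rintro q rfl a b
    exact (chartMetricCLM_self gM _ a b).symm
  -- The term in `D²ρ` produced here completes `Dρ(D²Φ')` to `D²(ρ ∘ Φ')`. After the chain rule for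
  -- `Φ ∘ σ`, only the image under `dF` of `D²σ(v, w)` remains as an error.
  have hchr := christoffelFirst_pullback gM g' hp hpull (F' x).1
    (fderiv ℝ Φ' z v) (fderiv ℝ Φ' z w) ξ.1
  simp only at hchr
  rw [← hK, ← hρ, ← zΦ', hchain, hchain, ← hη1'] at hchr
  have hneg : ∀ a b : ℝ, a - b = a + -1 * b := fun a b => by ring
  have l1 : covDerivPairing g' F' x v w ξ =
      K (fderiv ℝ ρ (Φ' z) (fderiv ℝ (fderiv ℝ Φ') z v w)) η.1
        - fderiv ℝ (fderiv ℝ h') z v w * η.2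
        + christoffelFirst g' (F' x).1 (fderiv ℝ Φ' z v) (fderiv ℝ Φ' z w) ξ.1 := by
    have e : g'.inner (F' x).1 (fderiv ℝ (fderiv ℝ Φ') z v w) ξ.1 =
        K (fderiv ℝ ρ (Φ' z) (fderiv ℝ (fderiv ℝ Φ') z v w)) η.1 := by
      rw [hη1, ← hL]
      exact (hpull _ _ _).trans (hmet _ rfl _ _)
    rw [← e, hη2, hneg, ← christoffelFirst_congr g' rfl (hpush' v) (hpush' w) rfl]
    rfl
  have r1 : covDerivPairing gM F (π x) (mfderiv (𝓡 n) (𝓡 n) π x v) (mfderiv (𝓡 n) (𝓡 n) π x w) η =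
      K (fderiv ℝ (fderiv ℝ Φ) (σ z) (fderiv ℝ σ z v) (fderiv ℝ σ z w)) η.1
        - fderiv ℝ (fderiv ℝ h) (σ z) (fderiv ℝ σ z v) (fderiv ℝ σ z w) * η.2
        + christoffelFirst gM (p (F' x).1) (fderiv ℝ Φ (σ z) (fderiv ℝ σ z v))
          (fderiv ℝ Φ (σ z) (fderiv ℝ σ z w)) η.1 := by
    rw [← hmet _ hy, hneg, ← christoffelFirst_congr gM hy
      ((hpush1 (mfderiv (𝓡 n) (𝓡 n) π x v)).trans (congrArg _ (hP v)))
      ((hpush1 (mfderiv (𝓡 n) (𝓡 n) π x w)).trans (congrArg _ (hP w))) rfl, ← hP, ← hP, zσ]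
    rfl
  have r2 : productForm (-1) gM (F (π x)).1
      (pushVec F (π x) (fderiv ℝ (fderiv ℝ σ) z v w)) η =
      K (fderiv ℝ Φ (σ z) (fderiv ℝ (fderiv ℝ σ) z v w)) η.1
        - fderiv ℝ h (σ z) (fderiv ℝ (fderiv ℝ σ) z v w) * η.2 := by
    rw [← hmet _ hy, hneg, ← hpush1, ← hpush2]
    rfl
  have d1' := congrArg (fun a => K a η.1) d1
  simp only [map_add, add_apply] at d1'
  rw [l1, r1, r2, hchr, d2]
  linear_combination d1'

end Naturality

/-! ### Naturality of the mean curvature -/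

section MeanCurvature

variable {n : ℕ}

/-- The trace of a bilinear form with respect to another one does not depend on the basis. -/
lemma sum_inv_gram_mul_comp (B T : LinearMap.BilinForm ℝ (EuclideanSpace ℝ (Fin n)))
    (Q : EuclideanSpace ℝ (Fin n) ≃ₗ[ℝ] EuclideanSpace ℝ (Fin n)) :
    let e : Fin n → EuclideanSpace ℝ (Fin n) := fun i => EuclideanSpace.single i (1 : ℝ)
    ∑ i, ∑ j, (Matrix.of fun i j => B (Q (e i)) (Q (e j)))⁻¹ i j * T (Q (e i)) (Q (e j)) =
      ∑ i, ∑ j, (Matrix.of fun i j => B (e i) (e j))⁻¹ i j * T (e i) (e j) := by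
  intro e
  let b := (EuclideanSpace.basisFun (Fin n) ℝ).toBasis
  have hb : ∀ i, b i = e i := fun i => by simp [b, e]
  let P := LinearMap.toMatrix b b Q.toLinearMap
  have hM : ∀ C : LinearMap.BilinForm ℝ (EuclideanSpace ℝ (Fin n)),
      (Matrix.of fun i j => C (e i) (e j)) = LinearMap.BilinForm.toMatrix b C := fun C => by
    ext i j
    simp [LinearMap.BilinForm.toMatrix_apply, hb]
  have hMQ : ∀ C : LinearMap.BilinForm ℝ (EuclideanSpace ℝ (Fin n)),
      (Matrix.of fun i j => C (Q (e i)) (Q (e j))) =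
        P.transpose * LinearMap.BilinForm.toMatrix b C * P := fun C => by
    rw [← LinearMap.BilinForm.toMatrix_comp b b C]
    ext i j
    simp [LinearMap.BilinForm.toMatrix_apply, hb]
  -- As a trace of a product, the sum is unchanged when both matrices `X` become `Pᵀ X P`: the
  -- factors `Pᵀ` cancel directly and `P` by cyclicity.
  have hsum : ∀ A C : Matrix (Fin n) (Fin n) ℝ,
      ∑ i, ∑ j, A i j * C i j = (A * C.transpose).trace := fun A C => by
    simp [Matrix.trace, Matrix.mul_apply]
  have hP : IsUnit P.det := LinearEquiv.isUnit_det Q b b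
  have h1 := hsum (Matrix.of fun i j => B (Q (e i)) (Q (e j)))⁻¹
    (Matrix.of fun i j => T (Q (e i)) (Q (e j)))
  have h2 := hsum (Matrix.of fun i j => B (e i) (e j))⁻¹ (Matrix.of fun i j => T (e i) (e j))
  simp only [Matrix.of_apply] at h1 h2
  rw [h1, h2, hMQ, hMQ, hM, hM]
  set G := LinearMap.BilinForm.toMatrix b B
  set A := LinearMap.BilinForm.toMatrix b T
  have hPt : IsUnit P.transpose.det := by rwa [Matrix.det_transpose]
  rw [Matrix.mul_inv_rev, Matrix.mul_inv_rev, Matrix.transpose_mul, Matrix.transpose_mul,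
    Matrix.transpose_transpose]
  calc (P⁻¹ * (G⁻¹ * P.transpose⁻¹) * (P.transpose * (A.transpose * P))).trace
      = (P⁻¹ * (G⁻¹ * (P.transpose⁻¹ * P.transpose) * A.transpose) * P).trace := by
        simp only [Matrix.mul_assoc]
    _ = (P⁻¹ * (G⁻¹ * A.transpose) * P).trace := by
        rw [Matrix.nonsing_inv_mul _ hPt, Matrix.mul_one]
    _ = (G⁻¹ * A.transpose).trace := by
        rw [Matrix.mul_assoc, Matrix.trace_mul_comm, Matrix.mul_assoc, Matrix.mul_nonsing_inv _ hP,
          Matrix.mul_one]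

variable {M : Type*} [TopologicalSpace M] [ChartedSpace (EuclideanSpace ℝ (Fin n)) M]
  [IsManifold (𝓡 n) ∞ M]
  {S : Type*} [TopologicalSpace S] [ChartedSpace (EuclideanSpace ℝ (Fin n)) S]
  {gM : RMetric n M} {F : S → M × ℝ} {ν : ∀ x : S, TangentSpace (𝓡 n) (F x).1 × ℝ}

lemma inducedForm_eq_chartMetricCLM (ε : ℝ) (gM : RMetric n M) (F : S → M × ℝ) (x : S)
    (v w : EuclideanSpace ℝ (Fin n)) :
    inducedForm ε gM F x v w =
      chartMetricCLM gM (F x).1 (extChartAt (𝓡 n) (F x).1 (F x).1) (pushVec F x v).1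
        (pushVec F x w).1 + ε * ((pushVec F x v).2 * (pushVec F x w).2) :=
  congrArg (fun a => a + ε * ((pushVec F x v).2 * (pushVec F x w).2))
    (chartMetricCLM_self gM (F x).1 (pushVec F x v).1 (pushVec F x w).1).symm

lemma exists_bilinForm_inducedForm (ε : ℝ) (gM : RMetric n M) (F : S → M × ℝ) (x : S) :
    ∃ B : LinearMap.BilinForm ℝ (EuclideanSpace ℝ (Fin n)),
      ∀ v w : EuclideanSpace ℝ (Fin n), inducedForm ε gM F x v w = B v w := by
  let D : EuclideanSpace ℝ (Fin n) →ₗ[ℝ] EuclideanSpace ℝ (Fin n) :=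
    (mfderiv (𝓡 n) (𝓡 n) (fun p => (F p).1) x).toLinearMap
  let d : EuclideanSpace ℝ (Fin n) →ₗ[ℝ] ℝ :=
    (mfderiv (𝓡 n) 𝓘(ℝ, ℝ) (fun p => (F p).2) x).toLinearMap
  let K := chartMetricCLM gM (F x).1 (extChartAt (𝓡 n) (F x).1 (F x).1)
  exact ⟨LinearMap.mk₂ ℝ (fun v w => K (D v) (D w) + ε * (d v * d w))
    (fun _ _ _ => by simp only [map_add, add_apply]; ring)
    (fun _ _ _ => by simp only [map_smul, smul_apply, smul_eq_mul]; ring)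
    (fun _ _ _ => by simp only [map_add]; ring)
    (fun _ _ _ => by simp only [map_smul, smul_eq_mul]; ring),
    inducedForm_eq_chartMetricCLM ε gM F x⟩

lemma covDerivPairing_eq_chartMetricCLM (gM : RMetric n M) (F : S → M × ℝ) (x : S)
    (ξ : EuclideanSpace ℝ (Fin n) × ℝ) (v w : EuclideanSpace ℝ (Fin n)) :
    covDerivPairing gM F x v w ξ =
      (chartMetricCLM gM (F x).1 (extChartAt (𝓡 n) (F x).1 (F x).1)
        (fderiv ℝ (fderiv ℝ (writtenInExtChartAt (𝓡 n) (𝓡 n) x (fun p => (F p).1)))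
          (extChartAt (𝓡 n) x x) v w) ξ.1 +
        -1 * (fderiv ℝ (fderiv ℝ (writtenInExtChartAt (𝓡 n) 𝓘(ℝ, ℝ) x (fun p => (F p).2)))
          (extChartAt (𝓡 n) x x) v w * ξ.2)) +
      christoffelFirst gM (F x).1 (pushVec F x v).1 (pushVec F x w).1 ξ.1 := by
  rw [chartMetricCLM_self]
  rfl

lemma exists_bilinForm_christoffelFirst (gM : RMetric n M) (y : M)
    (ζ : EuclideanSpace ℝ (Fin n)) (D : EuclideanSpace ℝ (Fin n) →ₗ[ℝ] EuclideanSpace ℝ (Fin n)) :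
    ∃ T : LinearMap.BilinForm ℝ (EuclideanSpace ℝ (Fin n)), ∀ v w,
      christoffelFirst gM y (D v) (D w) ζ = T v w := by
  set dK := fderiv ℝ (chartMetricCLM gM y) (extChartAt (𝓡 n) y y) with hdK
  exact ⟨LinearMap.mk₂ ℝ (fun v w => (dK (D v) (D w) ζ + dK (D w) (D v) ζ - dK ζ (D v) (D w)) / 2)
    (fun _ _ _ => by simp only [map_add, add_apply]; ring)
    (fun _ _ _ => by simp only [map_smul, smul_apply, smul_eq_mul]; ring)
    (fun _ _ _ => by simp only [map_add, add_apply]; ring)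
    (fun _ _ _ => by simp only [map_smul, smul_apply, smul_eq_mul]; ring),
    fun v w => christoffelFirst_eq gM y _ _ _⟩

lemma exists_bilinForm_covDerivPairing (gM : RMetric n M) (F : S → M × ℝ) (x : S)
    (ξ : EuclideanSpace ℝ (Fin n) × ℝ) :
    ∃ T : LinearMap.BilinForm ℝ (EuclideanSpace ℝ (Fin n)),
      ∀ v w : EuclideanSpace ℝ (Fin n), covDerivPairing gM F x v w ξ = T v w := by
  obtain ⟨T, hT⟩ := exists_bilinForm_christoffelFirst gM (F x).1 ξ.1
    (mfderiv (𝓡 n) (𝓡 n) (fun p => (F p).1) x).toLinearMap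
  let K := chartMetricCLM gM (F x).1 (extChartAt (𝓡 n) (F x).1 (F x).1)
  let D2 := fderiv ℝ (fderiv ℝ (writtenInExtChartAt (𝓡 n) (𝓡 n) x (fun p => (F p).1)))
          (extChartAt (𝓡 n) x x)
  let d2 := fderiv ℝ (fderiv ℝ (writtenInExtChartAt (𝓡 n) 𝓘(ℝ, ℝ) x (fun p => (F p).2)))
          (extChartAt (𝓡 n) x x)
  exact ⟨LinearMap.mk₂ ℝ (fun v w => (K (D2 v w) ξ.1 + -1 * (d2 v w * ξ.2)) + T v w)
    (fun _ _ _ => by simp only [map_add, add_apply, LinearMap.add_apply]; ring)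
    (fun _ _ _ => by simp only [map_smul, smul_apply, LinearMap.smul_apply, smul_eq_mul]; ring)
    (fun _ _ _ => by simp only [map_add, add_apply]; ring)
    (fun _ _ _ => by simp only [map_smul, smul_apply, smul_eq_mul]; ring),
    fun v w => (covDerivPairing_eq_chartMetricCLM gM F x ξ v w).trans
      (congrArg (fun a => _ + a) (hT v w))⟩

/-- A spacelike immersion has only one future-pointing unit normal vector at each point. -/
lemma IsFutureUnitNormal.eq_of_normal (hF : IsSpacelikeImmersion gM F)
    (hν : IsFutureUnitNormal gM F ν) (x : S) (ξ : TangentSpace (𝓡 n) (F x).1 × ℝ)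
    (h1 : ∀ v : TangentSpace (𝓡 n) x, productForm (-1) gM (F x).1 (pushVec F x v) ξ = 0)
    (h2 : productForm (-1) gM (F x).1 ξ ξ = -1)
    (h3 : productForm (-1) gM (F x).1 ξ (0, 1) < 0) : ξ = ν x := by
  let D : EuclideanSpace ℝ (Fin n) →ₗ[ℝ] EuclideanSpace ℝ (Fin n) :=
    (mfderiv (𝓡 n) (𝓡 n) (fun p => (F p).1) x).toLinearMap
  -- Spacelikeness gives `|V|² ≥ g(v, v) > 0`. With equal dimensions every horizontal vector is then
  -- the projection of a tangent one.
  have hinj : Function.Injective D := by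
    refine (injective_iff_map_eq_zero D).2 fun v hv => ?_
    by_contra hne
    have hpos := hF.pos x v hne
    have hle := inducedForm_neg_one_le (gM := gM) (F := F) x v
    have hz : gM.inner (F x).1 (pushVec F x v).1 (pushVec F x v).1 = 0 := by
      have : (pushVec F x v).1 = 0 := hv
      rw [this, map_zero]
    linarith
  have hsurj : Function.Surjective D := LinearMap.injective_iff_surjective.1 hinj
  have hξ2 : 0 < ξ.2 := by
    simp only [productForm, map_zero] at h3
    linarith
  have hξ1 : gM.inner (F x).1 ξ.1 ξ.1 = ξ.2 ^ 2 - 1 := by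
    simp only [productForm] at h2
    linarith
  have hν2 := hν.snd_pos x
  -- This vector is the projection `V` of some tangent `(V, a)`. The two orthogonality relations
  -- give `g_M(V, V) = ν_t a ξ_t - ξ_t a ν_t = 0`. So the normals are proportional, and the unit and
  -- future conditions fix the factor.
  have hprop : (ν x).2 • ξ.1 - ξ.2 • (ν x).1 = 0 := by
    by_contra hne
    obtain ⟨v, hv⟩ : ∃ v : TangentSpace (𝓡 n) x,
        (pushVec F x v).1 = (ν x).2 • ξ.1 - ξ.2 • (ν x).1 := hsurj _
    have e1 := h1 v
    have e2 := hν.inner_pushVec x v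
    have e3 := gM.pos (F x).1 _ hne
    rw [← hv] at e3
    simp only [productForm] at e1
    have e4 := congrArg (fun u => gM.inner (F x).1 (pushVec F x v).1 u) hv
    simp only [map_sub, map_smul, smul_eq_mul] at e4
    rw [e4, e2] at e3
    nlinarith
  have hprop' : (ν x).2 • ξ.1 = ξ.2 • (ν x).1 := sub_eq_zero.1 hprop
  have hsq : (ν x).2 ^ 2 * (ξ.2 ^ 2 - 1) = ξ.2 ^ 2 * ((ν x).2 ^ 2 - 1) := by
    rw [← hξ1, ← hν.inner_fst x]
    have := congrArg (fun u => gM.inner (F x).1 u u) hprop'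
    simp only [map_smul, smul_apply, smul_eq_mul] at this
    linarith
  have heq : ξ.2 = (ν x).2 := by
    have : ξ.2 ^ 2 = (ν x).2 ^ 2 := by linarith
    exact (pow_left_inj₀ hξ2.le hν2.le two_ne_zero).1 this
  refine Prod.ext ?_ heq
  rw [heq] at hprop'
  exact smul_right_injective _ hν2.ne' hprop'

variable
  {M' : Type*} [TopologicalSpace M'] [ChartedSpace (EuclideanSpace ℝ (Fin n)) M']
  [IsManifold (𝓡 n) ∞ M']
  {S' : Type*} [TopologicalSpace S'] [ChartedSpace (EuclideanSpace ℝ (Fin n)) S']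
  {g' : RMetric n M'} {F' : S' → M' × ℝ} {ν' : ∀ x : S', TangentSpace (𝓡 n) (F' x).1 × ℝ}
  {p : M' → M} {π : S' → S}

lemma IsUniversalLift.contMDiff_base (h : IsUniversalLift gM F p g' π F') :
    ContMDiff (𝓡 n) (𝓡 n) ∞ p :=
  h.baseCover.localDiffeo.contMDiff

lemma IsUniversalLift.contMDiff_domain (h : IsUniversalLift gM F p g' π F') :
    ContMDiff (𝓡 n) (𝓡 n) ∞ π :=
  h.domainCover.localDiffeo.contMDiff

lemma IsUniversalLift.fst_eq (h : IsUniversalLift gM F p g' π F') (x : S') :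
    (F (π x)).1 = p (F' x).1 :=
  (congrArg Prod.fst (h.commutes x)).symm

lemma IsUniversalLift.exists_linearEquiv [IsManifold (𝓡 n) ∞ S] [IsManifold (𝓡 n) ∞ S']
    (h : IsUniversalLift gM F p g' π F') (x : S') :
    ∃ Q : EuclideanSpace ℝ (Fin n) ≃ₗ[ℝ] EuclideanSpace ℝ (Fin n),
      ∀ v, Q v = mfderiv (𝓡 n) (𝓡 n) π x v :=
  ⟨(h.domainCover.localDiffeo.mfderivToContinuousLinearEquiv (by simp) x).toLinearEquiv,
    fun v => congrArg (fun A => A v)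
      (h.domainCover.localDiffeo.mfderivToContinuousLinearEquiv_coe (by simp) (x := x))⟩

lemma IsUniversalLift.inducedForm_eq (h : IsUniversalLift gM F p g' π F')
    (hF : IsSpacelikeImmersion gM F) (ε : ℝ) (x : S') (v w : EuclideanSpace ℝ (Fin n)) :
    inducedForm ε g' F' x v w = inducedForm ε gM F (π x) (mfderiv (𝓡 n) (𝓡 n) π x v)
      (mfderiv (𝓡 n) (𝓡 n) π x w) := by
  have e := fun v => pushVec_fst_lift h.contMDiff_base h.contMDiff_domain hF.smooth h.smooth
    h.commutes x v
  have e' := fun v => pushVec_snd_lift h.contMDiff_domain hF.smooth h.commutes x v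
  refine (productForm_lift ε h.pullback _ _ _).trans ?_
  refine Eq.trans ?_ (productForm_congr ε gM (h.fst_eq x) _ _).symm
  exact congrArg₂ (fun V W : EuclideanSpace ℝ (Fin n) × ℝ => productForm ε gM (p (F' x).1) V W)
    (Prod.ext (e v).symm (e' v).symm) (Prod.ext (e w).symm (e' w).symm)

/-- The differential of `p × id` preserves the product forms and that of `π` is onto, so the
pushed-forward vector is again a future unit normal; uniqueness concludes. -/
lemma IsUniversalLift.normal_eq [IsManifold (𝓡 n) ∞ S] [IsManifold (𝓡 n) ∞ S']
    (h : IsUniversalLift gM F p g' π F') (hF : IsSpacelikeImmersion gM F)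
    (hν : IsFutureUnitNormal gM F ν) (hν' : IsFutureUnitNormal g' F' ν') (x : S') :
    ((mfderiv (𝓡 n) (𝓡 n) p (F' x).1 (ν' x).1, (ν' x).2) : EuclideanSpace ℝ (Fin n) × ℝ) =
      ν (π x) := by
  obtain ⟨Q, hQ⟩ := h.exists_linearEquiv x
  refine hν.eq_of_normal hF (π x) _ ?_ ?_ ?_
  · intro v
    obtain ⟨u, hu⟩ := Q.surjective v
    rw [hQ] at hu
    have e := pushVec_fst_lift h.contMDiff_base h.contMDiff_domain hF.smooth h.smooth
      h.commutes x u
    have e' := pushVec_snd_lift h.contMDiff_domain hF.smooth h.commutes x u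
    rw [hu] at e e'
    refine (productForm_congr (-1) gM (h.fst_eq x) _ _).trans ?_
    refine Eq.trans ?_ ((productForm_lift (-1) h.pullback _ _ _).symm.trans (hν'.normal x u))
    exact congrArg (fun V : EuclideanSpace ℝ (Fin n) × ℝ =>
      productForm (-1) gM (p (F' x).1) V _) (Prod.ext e e')
  · exact (productForm_congr (-1) gM (h.fst_eq x) _ _).trans
      ((productForm_lift (-1) h.pullback _ _ _).symm.trans (hν'.unit x))
  · have e := hν'.future x
    rw [productForm_lift (-1) h.pullback, map_zero] at e
    exact (productForm_congr (-1) gM (h.fst_eq x) _ _).trans_lt e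

lemma IsUniversalLift.secondFundForm_eq [IsManifold (𝓡 n) ∞ S] [IsManifold (𝓡 n) ∞ S']
    (h : IsUniversalLift gM F p g' π F') (hF : IsSpacelikeImmersion gM F)
    (hν : IsFutureUnitNormal gM F ν) (hν' : IsFutureUnitNormal g' F' ν') (x : S')
    (v w : EuclideanSpace ℝ (Fin n)) :
    secondFundForm g' F' ν' x v w = secondFundForm gM F ν (π x) (mfderiv (𝓡 n) (𝓡 n) π x v)
      (mfderiv (𝓡 n) (𝓡 n) π x w) := by
  have e := h.normal_eq hF hν hν' x
  have key := covDerivPairing_lift h.contMDiff_base h.contMDiff_domain hF.smooth h.smooth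
    h.commutes h.pullback x v w (ν' x) (ν (π x)) (congrArg Prod.fst e).symm
    (congrArg Prod.snd e).symm
  -- The error term in the comparison of covariant derivatives is tangential, hence orthogonal to
  -- the normal.
  have hz := hν.normal (π x) (fderiv ℝ (fderiv ℝ (writtenInExtChartAt (𝓡 n) (𝓡 n) x π))
    (extChartAt (𝓡 n) x x) v w)
  unfold secondFundForm
  rw [key]
  exact congrArg Neg.neg ((congrArg (fun a => _ + a) hz).trans (add_zero _))

/-- The mean curvature of the lift of an immersion to the universal coverings. -/
theorem IsUniversalLift.meanCurvature_eq [IsManifold (𝓡 n) ∞ S] [IsManifold (𝓡 n) ∞ S']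
    (h : IsUniversalLift gM F p g' π F') (hF : IsSpacelikeImmersion gM F)
    (hν : IsFutureUnitNormal gM F ν) (hν' : IsFutureUnitNormal g' F' ν') (x : S') :
    meanCurvature g' F' ν' x = meanCurvature gM F ν (π x) := by
  obtain ⟨Q, hQ⟩ := h.exists_linearEquiv x
  obtain ⟨B, hB⟩ := exists_bilinForm_inducedForm (-1) gM F (π x)
  obtain ⟨T, hT⟩ := exists_bilinForm_covDerivPairing gM F (π x) (ν (π x))
  have e1 : ∀ v w : EuclideanSpace ℝ (Fin n), inducedForm (-1) g' F' x v w = B (Q v) (Q w) := by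
    intro v w
    rw [hQ, hQ]
    exact (h.inducedForm_eq hF (-1) x v w).trans (hB _ _)
  have e2 : ∀ v w : EuclideanSpace ℝ (Fin n),
      secondFundForm g' F' ν' x v w = (-T) (Q v) (Q w) := by
    intro v w
    rw [hQ, hQ]
    exact (h.secondFundForm_eq hF hν hν' x v w).trans (congrArg Neg.neg (hT _ _))
  have e3 : ∀ v w : EuclideanSpace ℝ (Fin n),
      secondFundForm gM F ν (π x) v w = (-T) v w := fun v w => congrArg Neg.neg (hT v w)
  have key := sum_inv_gram_mul_comp B (-T) Q
  simp only [← e1, ← e2] at key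
  simp only [← e3, ← hB] at key
  exact key

end MeanCurvature

/-! ### Lifts of curves to the universal coverings -/

section Lift

variable {n : ℕ}

/-- Path lifting yields a continuous lift; near each time it equals a local inverse of `π` composed
with `γ`, so it is as regular as `γ`. -/
lemma exists_contMDiffOn_lift {S S' : Type*} [TopologicalSpace S]
    [ChartedSpace (EuclideanSpace ℝ (Fin n)) S] [TopologicalSpace S']
    [ChartedSpace (EuclideanSpace ℝ (Fin n)) S'] {π : S' → S}
    (hcov : IsCoveringMap π) (hπ : IsLocalDiffeomorph (𝓡 n) (𝓡 n) ∞ π) {γ : ℝ → S}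
    (hγ : ContMDiffOn 𝓘(ℝ, ℝ) (𝓡 n) 1 γ (Icc 0 1)) {x : S'} (hx : γ 0 = π x) :
    ∃ γ' : ℝ → S', ContMDiffOn 𝓘(ℝ, ℝ) (𝓡 n) 1 γ' (Icc 0 1) ∧ γ' 0 = x ∧
      ∀ t ∈ Icc (0 : ℝ) 1, π (γ' t) = γ t := by
  let g : C(unitInterval, S) := ⟨fun t => γ t, hγ.continuousOn.domRestrict⟩
  obtain ⟨Γ, hΓ, hΓ0⟩ := hcov.exists_path_lifts g x hx
  let γ' : ℝ → S' := fun t => Γ (projIcc 0 1 zero_le_one t)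
  have hc : Continuous γ' := Γ.continuous.comp continuous_projIcc
  have hlift : ∀ t ∈ Icc (0 : ℝ) 1, π (γ' t) = γ t := fun t ht => by
    have := congrFun hΓ (projIcc 0 1 zero_le_one t)
    rw [projIcc_of_mem zero_le_one ht] at this
    simp only [γ', projIcc_of_mem zero_le_one ht]
    exact this
  refine ⟨γ', fun t ht => ?_, ?_, hlift⟩
  · have hloc := hπ (γ' t)
    have hev : γ' =ᶠ[𝓝[Icc 0 1] t] hloc.localInverse ∘ γ := by
      have h1 := (hc.continuousAt (x := t)).eventually hloc.localInverse_eventuallyEq_left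
      filter_upwards [nhdsWithin_le_nhds h1, self_mem_nhdsWithin] with s hs hs'
      simp only [Function.comp_apply, id] at hs ⊢
      rw [← hlift s hs', hs]
    have h2 : ContMDiffAt (𝓡 n) (𝓡 n) 1 hloc.localInverse (γ t) := by
      rw [← hlift t ht]
      exact hloc.localInverse_contMDiffAt.of_le (by simp)
    exact (h2.comp_contMDiffWithinAt t (hγ t ht)).congr_of_eventuallyEq hev
      (hev.self_of_nhdsWithin ht)
  · simp only [γ', projIcc_left]
    exact hΓ0

/-- The curves `p ∘ F' ∘ γ'` and `F ∘ γ` agree only on `[0, 1]`, so their speeds are compared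
through germs at interior times. -/
lemma formSpeed_congr {X : Type*} [TopologicalSpace X]
    [ChartedSpace (EuclideanSpace ℝ (Fin n)) X]
    (q : ∀ x : X, TangentSpace (𝓡 n) x → TangentSpace (𝓡 n) x → ℝ) {β β' : ℝ → X} {t : ℝ}
    (h : β =ᶠ[𝓝 t] β') : formSpeed q β t = formSpeed q β' t := by
  have key : ∀ (x y : X) (_ : x = y) (v w : EuclideanSpace ℝ (Fin n)), v = w →
      √(q x v v) = √(q y w w) := by
    rintro x _ rfl v _ rfl; rfl
  exact key _ _ h.self_of_nhds _ _ (congrArg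
    (fun A : ℝ →L[ℝ] EuclideanSpace ℝ (Fin n) => A 1) h.mfderiv_eq)

variable {M : Type*} [TopologicalSpace M] [ChartedSpace (EuclideanSpace ℝ (Fin n)) M]
  [IsManifold (𝓡 n) ∞ M]
  {M' : Type*} [TopologicalSpace M'] [ChartedSpace (EuclideanSpace ℝ (Fin n)) M']
  [IsManifold (𝓡 n) ∞ M']
  {gM : RMetric n M} {g' : RMetric n M'} {p : M' → M}

lemma formSpeed_pullback (hp : ContMDiff (𝓡 n) (𝓡 n) ∞ p)
    (hpull : ∀ (y : M') (v w : TangentSpace (𝓡 n) y),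
      g'.inner y v w = gM.inner (p y) (mfderiv (𝓡 n) (𝓡 n) p y v) (mfderiv (𝓡 n) (𝓡 n) p y w))
    {β : ℝ → M'} {t : ℝ} (hβ : MDifferentiableAt 𝓘(ℝ, ℝ) (𝓡 n) β t) :
    formSpeed (metricForm g') β t = formSpeed (metricForm gM) (fun s => p (β s)) t := by
  have e := congrArg (fun A : ℝ →L[ℝ] EuclideanSpace ℝ (Fin n) => A 1)
    (mfderiv_comp t (hp.mdifferentiableAt (by simp) (x := β t)) hβ)
  exact congrArg Real.sqrt ((hpull _ _ _).trans
    (congrArg (fun v : EuclideanSpace ℝ (Fin n) => gM.inner (p (β t)) v v) e).symm)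

variable
  {S : Type*} [TopologicalSpace S] [ChartedSpace (EuclideanSpace ℝ (Fin n)) S]
  [IsManifold (𝓡 n) ∞ S]
  {S' : Type*} [TopologicalSpace S'] [ChartedSpace (EuclideanSpace ℝ (Fin n)) S']
  [IsManifold (𝓡 n) ∞ S']
  {F : S → M × ℝ} {ν : ∀ x : S, TangentSpace (𝓡 n) (F x).1 × ℝ} {c : ℝ}
  {F' : S' → M' × ℝ} {ν' : ∀ x : S', TangentSpace (𝓡 n) (F' x).1 × ℝ} {π : S' → S}

/-- The bound on the normal in terms of the distance in the universal covering of `M`. -/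
lemma IsTranslatingSoliton.normal_bound_of_universal_lift (hF : IsTranslatingSoliton gM F ν c)
    (h : IsUniversalLift gM F p g' π F') (hν' : IsFutureUnitNormal g' F' ν')
    {o : M'} {G : ℝ → ℝ} (hG : IsPrimaryBound G)
    (hH : ∀ x : S', meanCurvature g' F' ν' x ≤ G (formDist (metricForm g') o (F' x).1)) (x : S) :
    ∃ C : ℝ, ∀ y : S, formEDist (inducedForm (-1) gM F) x y < 2 → (ν y).2 ≤ C := by
  -- All curves from the centre of the ball are lifted from this one point. The endpoint over `y`
  -- depends on the curve, but the resulting bound `B` does not.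
  obtain ⟨x', rfl⟩ := h.domainCover.surjective x
  obtain ⟨B, hB⟩ := hG.exists_bound
    ((∫ s in (0 : ℝ)..(formDist (metricForm g') o (F' x').1), 1 / G s) + c⁻¹ * 2)
  have hHπ : ∀ z : S', meanCurvature gM F ν (π z) ≤ G (formDist (metricForm g') o (F' z).1) :=
    fun z => (h.meanCurvature_eq hF.immersion hF.normal hν' z).symm.trans_le (hH z)
  refine ⟨c⁻¹ * B, fun y hy => ?_⟩
  obtain ⟨γ, h0, h1, hγ, hlt⟩ := exists_formLength_lt hy
  obtain ⟨γ', hγ', h0', hlift⟩ := exists_contMDiffOn_lift h.domainCover.covering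
    h.domainCover.localDiffeo hγ h0
  have hβ : ContMDiffOn 𝓘(ℝ, ℝ) (𝓡 n) 1 (fun t => (F' (γ' t)).1) (Icc 0 1) :=
    (h.smooth.fst.of_le (by simp)).comp_contMDiffOn hγ'
  have key := hF.integral_inv_le_of_lift g' hβ hγ (o := o) (fun t ht => ?_) hlt hG (fun t ht => ?_)
  · have hy' : y = π (γ' 1) := by rw [hlift 1 (right_mem_Icc.2 zero_le_one), h1]
    rw [hy']
    refine hF.normal_le ((hHπ (γ' 1)).trans (hB _ ENNReal.toReal_nonneg ?_))
    simpa only [h0'] using key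
  · rw [formSpeed_pullback h.contMDiff_base h.pullback (mdifferentiableAt_of_mem_Ioo hβ ht)]
    refine formSpeed_congr _ ?_
    filter_upwards [Icc_mem_nhds ht.1 ht.2] with s hs
    rw [← hlift s hs, h.fst_eq]
  · rw [← hlift t (Ioo_subset_Icc_self ht)]
    exact hHπ (γ' t)

end Lift

end

theorem corollary3p9 {n : ℕ}
    {M : Type*} [TopologicalSpace M] [T2Space M] [ConnectedSpace M]
    [ChartedSpace (EuclideanSpace ℝ (Fin n)) M] [IsManifold (𝓡 n) ∞ M]
    (gM : RMetric n M) (hM : FormComplete (metricForm gM))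
    {S : Type*} [TopologicalSpace S] [T2Space S] [ConnectedSpace S]
    [ChartedSpace (EuclideanSpace ℝ (Fin n)) S] [IsManifold (𝓡 n) ∞ S]
    (F : S → M × ℝ) (hproper : IsProperMap F)
    (ν : ∀ x : S, TangentSpace (𝓡 n) (F x).1 × ℝ) (c : ℝ)
    (hF : IsTranslatingSoliton gM F ν c) :
    -- (1a)
    (∀ (o : S) (G : ℝ → ℝ), IsPrimaryBound G →
      (∀ x : S, meanCurvature gM F ν x ≤ G (formDist (inducedForm 1 gM F) o x)) →
      FormComplete (inducedForm (-1) gM F)) ∧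
    -- (1b)
    (∀ (o : S) (G : ℝ → ℝ), ContinuousOn G (Ici 0) → (∀ s : ℝ, 0 ≤ s → 0 < G s) →
      (∀ x : S, meanCurvature gM F ν x ≤ G (formDist (inducedForm (-1) gM F) o x)) →
      FormComplete (inducedForm (-1) gM F)) ∧
    -- (2a)
    (IsGraph F →
      ∀ (oM : M) (G : ℝ → ℝ), (IsMonotonePrimaryBound G ∨ IsSmoothPrimaryBound G) →
      (∀ x : S, meanCurvature gM F ν x ≤ G (formDist (metricForm gM) oM (F x).1)) →
      FormComplete (inducedForm (-1) gM F)) ∧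
    -- (2b)
    (∀ (M' : Type*) [TopologicalSpace M'] [T2Space M']
      [ChartedSpace (EuclideanSpace ℝ (Fin n)) M'] [IsManifold (𝓡 n) ∞ M']
      (S' : Type*) [TopologicalSpace S'] [T2Space S']
      [ChartedSpace (EuclideanSpace ℝ (Fin n)) S'] [IsManifold (𝓡 n) ∞ S']
      (p : M' → M) (g' : RMetric n M') (π : S' → S) (F' : S' → M' × ℝ)
      (ν' : ∀ x : S', TangentSpace (𝓡 n) (F' x).1 × ℝ),
      IsUniversalLift gM F p g' π F' → IsFutureUnitNormal g' F' ν' →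
      ∀ (o' : M') (G : ℝ → ℝ), (IsMonotonePrimaryBound G ∨ IsSmoothPrimaryBound G) →
      (∀ x : S', meanCurvature g' F' ν' x ≤ G (formDist (metricForm g') o' (F' x).1)) →
      FormComplete (inducedForm (-1) gM F)) := by
  have key := formComplete_of_normal_bound hM hproper hF.immersion hF.normal
  exact ⟨fun o G hG hH => key (hF.normal_bound_of_euclidean_dist hG hH),
    fun o G hG _ hH => key (hF.normal_bound_of_induced_dist hG hH),
    fun _ o G hG hH => key (hF.normal_bound_of_base_dist (isPrimaryBound_of_or hG) hH),
    fun M' _ _ _ _ S' _ _ _ _ p g' π F' ν' hl hν' o' G hG hH =>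
      key (hF.normal_bound_of_universal_lift hl hν' (isPrimaryBound_of_or hG) hH)⟩
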